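/- Let $n\ge 2$, $1<q\le \frac{n}{n-1}$ and $\alpha=n-q(n-1)$. Notation: $\mathrm{Lip}_c$ denotes Lipschitz maps with compact support on $\mathbb R^n$ (a.e. differentiable, with a.e. gradient $\nabla u$ and divergence $\operatorname{div}\Phi$). All quantities below take values in $[0,\infty]$, with $0\cdot\infty=0$. For a locally finite Borel measure $\mu$ on $\mathbb R^n$ put $$M_\alpha\mu(x)=\sup_{r>0} r^\alpha\,\frac{\mu(B_r(x))}{|B_r(x)|},\qquad \|f\|_{L^{q,1}(\mu)}=q\int_0^\infty \mu(\{|f|>t\})^{1/q}\,dt,\qquad \|f\|_{L^{q,\infty}(\mu)}=\sup_{t>0}t\,\mu(\{|f|>t\})^{1/q},$$ let $I_1f(x)=\frac1{\gamma(1)}\int_{\mathbb R^n}\frac{f(y)}{|x-y|^{n-1}}\,dy$ for $f\ge 0$, where $\gamma(1)=2\pi^{n/2}\Gamma(1/2)/\Gamma((n-1)/2)$, and for $w:\mathbb R^n\to[0,\infty]$ let $\|\nabla u\|_{L^1(w)}=\int_{\mathbb R^n}|\nabla u|\,w\,dx$ and $$\operatorname{Per}(\Omega,w)=\sup\Big\{\int_\Omega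 \operatorname{div}\Phi\,dx:\ \Phi\in \mathrm{Lip}_c(\mathbb R^n,\mathbb R^n),\ |\Phi(x)|\le w(x)\ \text{for all }x\Big\}.$$ A bounded open set $\Omega$ has finite $w$-perimeter if $\int_\Omega w\,dx<\infty$ and $\operatorname{Per}(\Omega,w)<\infty$. Then the following statements are equivalent: 1. there is a finite constant $C_1$ such that $\|u\|_{L^{q,1}(\mu)}\le C_1\|\nabla u\|_{L^1((M_\alpha\mu)^{1/q})}$ for all locally finite Borel measures $\mu$ on $\mathbb R^n$ and all $u\in \mathrm{Lip}_c(\mathbb R^n)$; 2. there is a finite constant $C_2$ such that $|u(x)|\le C_2\, I_1(|\nabla u|)(x)$ for all $u\in \mathrm{Lip}_c(\mathbb R^n)$ and all $x\in\mathbb R^n$; 3. there is a finite constant $C_3$ such that $\|u\|_{L^{q,\infty}(\mu)}\le C_3\|\nabla u\|_{L^1((M_\alpha\mu)^{1/q})}$ for all locally finite Borel measures $\mu$ on $\mathbb R^n$ and all $u\in \mathrm{Lip}_c(\mathbb R^n)$; 4. there is a finite constant $C_4$ such that $\mu(\Omega)^{1/q}\le C_4\operatorname{Per}(\Omega,(M_\alpha\mu)^{1/q})$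 for all locally finite Borel measures $\mu$ on $\mathbb R^n$ and all bounded open sets $\Omega\subset\mathbb R^n$ with finite $(M_\alpha\mu)^{1/q}$-perimeter. Moreover, the constants are comparable up to dimensional factors: there is a constant $K=K(n)$, depending only on $n$ (not on $q$), such that for all $i,j\in\{1,2,3,4\}$ and every $C\ge 0$, if the inequality in statement $i$ holds with constant $C$, then the inequality in statement $j$ holds with constant $KC$. -/

import Mathlib

open MeasureTheory
open scoped ENNReal NNReal

noncomputable section

namespace EndpointSobolev

/-- Lipschitz maps with compact support. -/
def IsLipc {n : ℕ} {F : Type*} [NormedAddCommGroup F]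
    (u : EuclideanSpace ℝ (Fin n) → F) : Prop :=
  (∃ L : ℝ≥0, LipschitzWith L u) ∧ HasCompactSupport u

/-- The centred fractional maximal function
`M_α μ (x) = sup_{r > 0} r ^ α * μ(B_r(x)) / |B_r(x)|`, with values in `[0, ∞]`. -/
def fracMaximal {n : ℕ} (α : ℝ) (μ : Measure (EuclideanSpace ℝ (Fin n)))
    (x : EuclideanSpace ℝ (Fin n)) : ℝ≥0∞ :=
  ⨆ (r : ℝ) (_ : 0 < r),
    ENNReal.ofReal (r ^ α) * (μ (Metric.ball x r) / volume (Metric.ball x r))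

/-- The normalizing constant `γ(α) = 2 ^ α π ^ (n/2) Γ(α/2) / Γ((n-α)/2)`. -/
def rieszConst (n : ℕ) (α : ℝ) : ℝ :=
  2 ^ α * Real.pi ^ ((n : ℝ) / 2) * Real.Gamma (α / 2) / Real.Gamma (((n : ℝ) - α) / 2)

/-- The Riesz potential `I_α f (x) = γ(α)⁻¹ ∫ f(y) |x - y| ^ (α - n) dy` of a function
`f ≥ 0`, for `0 < α < n`. -/
def rieszPotential {n : ℕ} (α : ℝ) (f : EuclideanSpace ℝ (Fin n) → ℝ≥0∞)
    (x : EuclideanSpace ℝ (Fin n)) : ℝ≥0∞ :=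
  (∫⁻ y, f y / (‖x - y‖ₑ ^ ((n : ℝ) - α))) / ENNReal.ofReal (rieszConst n α)

/-- The Lorentz quasi-norm
`‖f‖_{L^{r,s}(μ)} = (r ∫_0^∞ t ^ (s-1) μ{|f| > t} ^ (s/r) dt) ^ (1/s)`, for `1 ≤ r, s < ∞`. -/
def lorentzNorm {n : ℕ} (r s : ℝ) (μ : Measure (EuclideanSpace ℝ (Fin n)))
    (f : EuclideanSpace ℝ (Fin n) → ℝ) : ℝ≥0∞ :=
  (ENNReal.ofReal r * ∫⁻ t in Set.Ioi (0 : ℝ),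
    ENNReal.ofReal (t ^ (s - 1)) * μ {x | t < |f x|} ^ (s / r)) ^ (1 / s)

/-- The weak quasi-norm `‖f‖_{L^{r,∞}(μ)} = sup_{t > 0} t μ{|f| > t} ^ (1/r)`. -/
def weakLorentzNorm {n : ℕ} (r : ℝ) (μ : Measure (EuclideanSpace ℝ (Fin n)))
    (f : EuclideanSpace ℝ (Fin n) → ℝ) : ℝ≥0∞ :=
  ⨆ (t : ℝ) (_ : 0 < t), ENNReal.ofReal t * μ {x | t < |f x|} ^ (1 / r)

/-- `‖∇u‖_{L¹(w)} = ∫ |∇u| w dx`. -/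
def gradNorm {n : ℕ} (u : EuclideanSpace ℝ (Fin n) → ℝ)
    (w : EuclideanSpace ℝ (Fin n) → ℝ≥0∞) : ℝ≥0∞ :=
  ∫⁻ x, ‖gradient u x‖ₑ * w x

/-- The divergence of a vector field. For Lipschitz fields it is the classical divergence at
almost every point. -/
def divergence {n : ℕ} (Φ : EuclideanSpace ℝ (Fin n) → EuclideanSpace ℝ (Fin n))
    (x : EuclideanSpace ℝ (Fin n)) : ℝ :=
  ∑ i, (fderiv ℝ Φ x (EuclideanSpace.single i 1)) i

/-- The weighted variation
`Var_w u = sup {∫ u div Φ dx : Φ ∈ Lip_c(ℝⁿ; ℝⁿ), |Φ| ≤ w everywhere}` of a locally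
integrable `u`. The supremum is nonnegative, as `Φ = 0` is admissible. -/
def weightedVar {n : ℕ} (w : EuclideanSpace ℝ (Fin n) → ℝ≥0∞)
    (u : EuclideanSpace ℝ (Fin n) → ℝ) : ℝ≥0∞ :=
  ⨆ (Φ : EuclideanSpace ℝ (Fin n) → EuclideanSpace ℝ (Fin n))
    (_ : IsLipc Φ ∧ ∀ x, ‖Φ x‖ₑ ≤ w x),
      ENNReal.ofReal (∫ x, u x * divergence Φ x)

/-- `u ∈ BV(w)`. -/
def IsWeightedBV {n : ℕ} (w : EuclideanSpace ℝ (Fin n) → ℝ≥0∞)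
    (u : EuclideanSpace ℝ (Fin n) → ℝ) : Prop :=
  LocallyIntegrable u ∧ (∫⁻ x, ‖u x‖ₑ * w x) < ∞ ∧ weightedVar w u < ∞

/-- `Per(Ω, w) = Var_w 1_Ω`. -/
def weightedPer {n : ℕ} (Ω : Set (EuclideanSpace ℝ (Fin n)))
    (w : EuclideanSpace ℝ (Fin n) → ℝ≥0∞) : ℝ≥0∞ :=
  weightedVar w (Ω.indicator 1)

/-- `Ω` has finite `w`-perimeter: `1_Ω ∈ BV(w)`. -/
def HasFinitePer {n : ℕ} (Ω : Set (EuclideanSpace ℝ (Fin n)))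
    (w : EuclideanSpace ℝ (Fin n) → ℝ≥0∞) : Prop :=
  IsWeightedBV w (Ω.indicator 1)

/-- The Lorentz Sobolev inequality with constant `C`. -/
def LorentzSobolev (n : ℕ) (q α : ℝ) (C : ℝ≥0) : Prop :=
  ∀ (μ : Measure (EuclideanSpace ℝ (Fin n))) [IsLocallyFiniteMeasure μ]
    (u : EuclideanSpace ℝ (Fin n) → ℝ), IsLipc u →
    lorentzNorm q 1 μ u ≤ C * gradNorm u (fun x => fracMaximal α μ x ^ (1 / q))

/-- The subrepresentation formula with constant `C`. -/
def Subrepresentation (n : ℕ) (C : ℝ≥0) : Prop :=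
  ∀ (u : EuclideanSpace ℝ (Fin n) → ℝ), IsLipc u → ∀ x,
    ‖u x‖ₑ ≤ C * rieszPotential 1 (fun y => ‖gradient u y‖ₑ) x

/-- The weak-type Sobolev inequality with constant `C`. -/
def WeakSobolev (n : ℕ) (q α : ℝ) (C : ℝ≥0) : Prop :=
  ∀ (μ : Measure (EuclideanSpace ℝ (Fin n))) [IsLocallyFiniteMeasure μ]
    (u : EuclideanSpace ℝ (Fin n) → ℝ), IsLipc u →
    weakLorentzNorm q μ u ≤ C * gradNorm u (fun x => fracMaximal α μ x ^ (1 / q))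

/-- The isoperimetric inequality with constant `C`. -/
def Isoperimetric (n : ℕ) (q α : ℝ) (C : ℝ≥0) : Prop :=
  ∀ (μ : Measure (EuclideanSpace ℝ (Fin n))) [IsLocallyFiniteMeasure μ]
    (Ω : Set (EuclideanSpace ℝ (Fin n))), IsOpen Ω → Bornology.IsBounded Ω →
    HasFinitePer Ω (fun x => fracMaximal α μ x ^ (1 / q)) →
    μ Ω ^ (1 / q) ≤ C * weightedPer Ω (fun x => fracMaximal α μ x ^ (1 / q))

end EndpointSobolev

end

noncomputable section

namespace EndpointSobolev

open Set Filter Topology Metric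
open scoped Convolution

variable {n : ℕ}

/-! All four inequalities are true with constants depending only on `n`, and none can hold with a
constant below some positive dimensional bound. Equivalence and comparability of constants then
follow at once, with `K` the ratio of the upper bound to the lower one.

The core is the isoperimetric inequality `measure_rpow_le_weightedPer`. Around each point of `Ω`
there is a ball of radius `r` in which both `Ω` and its complement occupy a definite proportion. A
dual relative isoperimetric inequality, obtained from an L¹ Poincaré estimate for mollified
indicators, provides a field of norm at most one, supported in the doubled ball, whose divergence
has integral at least a multiple of `r ^ (n - 1)` over `Ω`. Since `α - n = -q (n - 1)`, the weight
on that doubled ball is at least a multiple of `r ^ (-(n - 1)) * m ^ (1 / q)`, where `m` is the mass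
of a larger concentric ball, so the powers of `r` cancel. A Vitali selection makes the supports
disjoint, the weighted sum of the fields competes in the perimeter, and subadditivity of `t ^ (1 /
q)` recovers `μ Ω ^ (1 / q)`.

Half of the coarea formula turns this into the Lorentz inequality, which dominates the weak one. A
Dirac mass at `x` turns the weak inequality into the subrepresentation formula, because its
fractional maximal function to the power `1 / q` is a multiple of the kernel `|x - y| ^ (1 - n)`.
The lower bounds come from testing with a cutoff and with Lebesgue measure on the unit ball. -/

/-! ### An L¹ Poincaré inequality on convex sets -/

/-- Convexity keeps the contraction towards `z` inside `S`, and its inverse Jacobian `s ^ (-n)` is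
at most `2 ^ n` because `s ≥ 1 / 2`. -/
theorem setLIntegral_comp_lineMap_le {S : Set (EuclideanSpace ℝ (Fin n))}
    (hS : Convex ℝ S) (hSm : MeasurableSet S) {f : EuclideanSpace ℝ (Fin n) → ℝ≥0∞}
    (hf : Measurable f) {z : EuclideanSpace ℝ (Fin n)} (hz : z ∈ S) {s : ℝ}
    (hs : 1 / 2 ≤ s) (hs1 : s ≤ 1) :
    ∫⁻ y in S, f ((1 - s) • z + s • y) ≤ 2 ^ n * ∫⁻ p in S, f p := by
  have hs0 : 0 < s := by linarith
  have hg : Measurable (S.indicator f) := hf.indicator hSm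
  calc ∫⁻ y in S, f ((1 - s) • z + s • y)
      ≤ ∫⁻ y in S, S.indicator f ((1 - s) • z + s • y) := by
        refine setLIntegral_mono' hSm fun y hy => ?_
        rw [indicator_of_mem (hS hz hy (by linarith) hs0.le (by ring))]
    _ ≤ ∫⁻ y, S.indicator f ((1 - s) • z + s • y) := setLIntegral_le_lintegral _ _
    _ = ∫⁻ x, S.indicator f ((1 - s) • z + x) ∂(Measure.map (s • ·) volume) := by
        rw [lintegral_map (by fun_prop) (by fun_prop)]
    _ = ENNReal.ofReal |(s ^ n)⁻¹| * ∫⁻ p in S, f p := by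
        rw [Measure.map_addHaar_smul _ hs0.ne', lintegral_smul_measure,
          lintegral_add_left_eq_self, lintegral_indicator hSm]
        simp
    _ ≤ 2 ^ n * ∫⁻ p in S, f p := by
        gcongr
        rw [← ENNReal.ofReal_ofNat 2, ← ENNReal.ofReal_pow (by norm_num)]
        apply ENNReal.ofReal_le_ofReal
        rw [abs_of_pos (by positivity), ← inv_pow]
        gcongr
        rw [inv_le_comm₀ hs0 (by norm_num)]
        linarith

theorem enorm_sub_le_lintegral_fderiv {E : Type*} [NormedAddCommGroup E] [NormedSpace ℝ E]
    {v : E → ℝ} (hv : ContDiff ℝ 1 v) (y z : E) :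
    ‖v y - v z‖ₑ ≤ ‖y - z‖ₑ * ∫⁻ s in Icc (0 : ℝ) 1, ‖fderiv ℝ v ((1 - s) • z + s • y)‖ₑ := by
  set γ : ℝ → E := fun s => (1 - s) • z + s • y with hγ
  have hγd : ∀ s, HasDerivAt γ (y - z) s := fun s => by
    have h1 : HasDerivAt (fun s : ℝ => (1 - s) • z) ((-1 : ℝ) • z) s :=
      ((hasDerivAt_id s).const_sub 1).smul_const z
    have h2 : HasDerivAt (fun s : ℝ => s • y) ((1 : ℝ) • y) s := (hasDerivAt_id s).smul_const y
    convert! h1.add h2 using 1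
    simp; abel
  have hc : ContDiff ℝ 1 (v ∘ γ) := hv.comp (by rw [hγ]; fun_prop)
  have h := enorm_sub_le_lintegral_deriv_of_contDiffOn_Icc
    (a := 0) (b := 1) (hc.contDiffOn) zero_le_one
  simp only [hγ, Function.comp_apply] at h
  simp only [one_smul, sub_self, zero_smul, zero_add, sub_zero, add_zero] at h
  refine h.trans ?_
  rw [← lintegral_const_mul']
  · refine lintegral_mono fun s => ?_
    have hd : HasDerivAt (v ∘ γ) (fderiv ℝ v (γ s) (y - z)) s :=
      ((hv.differentiable (by simp)) (γ s)).hasFDerivAt.comp_hasDerivAt s (hγd s)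
    change ‖deriv (v ∘ γ) s‖ₑ ≤ _
    rw [hd.deriv, mul_comm]
    exact (fderiv ℝ v (γ s)).le_opENorm _
  · exact enorm_ne_top

/-- Integrate the derivative along segments and apply Tonelli, so that only a bound for each fixed
`s` is needed. -/
theorem lintegral_enorm_sub_le {S : Set (EuclideanSpace ℝ (Fin n))}
    (hS : Convex ℝ S) (hSm : MeasurableSet S) {d : ℝ}
    (hd : ∀ y ∈ S, ∀ z ∈ S, ‖y - z‖ ≤ d)
    {v : EuclideanSpace ℝ (Fin n) → ℝ} (hv : ContDiff ℝ 1 v) :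
    ∫⁻ z in S, ∫⁻ y in S, ‖v y - v z‖ₑ ≤
      ENNReal.ofReal d * (2 ^ n * volume S * ∫⁻ p in S, ‖fderiv ℝ v p‖ₑ) := by
  set f : EuclideanSpace ℝ (Fin n) → ℝ≥0∞ := fun p => ‖fderiv ℝ v p‖ₑ with hfdef
  have hfc : Continuous f := (hv.continuous_fderiv (by simp)).enorm
  have hf : Measurable f := hfc.measurable
  have hseg : ∀ s ∈ Icc (0 : ℝ) 1,
      ∫⁻ z in S, ∫⁻ y in S, f ((1 - s) • z + s • y) ≤ 2 ^ n * volume S * ∫⁻ p in S, f p := by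
    intro s hs
    have key : ∀ s' : ℝ, 1 / 2 ≤ s' → s' ≤ 1 →
        ∫⁻ z in S, ∫⁻ y in S, f ((1 - s') • z + s' • y) ≤
          2 ^ n * volume S * ∫⁻ p in S, f p := by
      intro s' h1 h2
      calc _ ≤ ∫⁻ z in S, 2 ^ n * ∫⁻ p in S, f p :=
            setLIntegral_mono' hSm fun z hz => setLIntegral_comp_lineMap_le hS hSm hf hz h1 h2
        _ = _ := by rw [setLIntegral_const]; ring
    rcases le_total (1 / 2) s with h | h
    · exact key s h hs.2
    -- For `s < 1 / 2` the contraction in `y` is too strong; exchanging `y` and `z` replaces `s` by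
    -- `1 - s`.
    · rw [lintegral_lintegral_swap]
      · have := key (1 - s) (by linarith) (by linarith [hs.1])
        refine le_trans (le_of_eq ?_) this
        simp only [sub_sub_cancel]
        simp_rw [add_comm]
      · refine (hf.comp (Continuous.measurable ?_)).aemeasurable; fun_prop
  calc ∫⁻ z in S, ∫⁻ y in S, ‖v y - v z‖ₑ
      ≤ ∫⁻ z in S, ∫⁻ y in S, ENNReal.ofReal d *
          ∫⁻ s in Icc (0 : ℝ) 1, f ((1 - s) • z + s • y) := by
        refine setLIntegral_mono' hSm fun z hz => setLIntegral_mono' hSm fun y hy => ?_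
        refine (enorm_sub_le_lintegral_fderiv hv y z).trans ?_
        gcongr
        rw [← ofReal_norm]
        exact ENNReal.ofReal_le_ofReal (hd y hy z hz)
    _ = ENNReal.ofReal d * ∫⁻ z in S, ∫⁻ y in S,
          ∫⁻ s in Icc (0 : ℝ) 1, f ((1 - s) • z + s • y) := by
        simp_rw [lintegral_const_mul' _ _ ENNReal.ofReal_ne_top]
    _ = ENNReal.ofReal d * ∫⁻ s in Icc (0 : ℝ) 1, ∫⁻ z in S, ∫⁻ y in S,
          f ((1 - s) • z + s • y) := by
        congr 1
        have h1 : ∀ z, ∫⁻ y in S, ∫⁻ s in Icc (0 : ℝ) 1, f ((1 - s) • z + s • y) =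
            ∫⁻ s in Icc (0 : ℝ) 1, ∫⁻ y in S, f ((1 - s) • z + s • y) := fun z => by
          rw [lintegral_lintegral_swap]
          refine (hf.comp (Continuous.measurable ?_)).aemeasurable; fun_prop
        simp_rw [h1]
        rw [lintegral_lintegral_swap]
        refine Measurable.aemeasurable ?_
        refine Measurable.lintegral_prod_right' (f := fun p :
          (EuclideanSpace ℝ (Fin n) × ℝ) × EuclideanSpace ℝ (Fin n) =>
            f ((1 - p.1.2) • p.1.1 + p.1.2 • p.2)) ?_
        refine hf.comp (Continuous.measurable ?_); fun_prop
    _ ≤ ENNReal.ofReal d * ∫⁻ s in Icc (0 : ℝ) 1, 2 ^ n * volume S * ∫⁻ p in S, f p := by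
        gcongr ENNReal.ofReal d * ?_
        exact setLIntegral_mono' measurableSet_Icc hseg
    _ = _ := by rw [setLIntegral_const]; simp

/-! ### Mollification and the divergence -/

section Mollify

variable {F : Type*} [NormedAddCommGroup F] [NormedSpace ℝ F]

/-- The convolution `ρ * f`. -/
def mollify (ρ : EuclideanSpace ℝ (Fin n) → ℝ) (f : EuclideanSpace ℝ (Fin n) → F) :
    EuclideanSpace ℝ (Fin n) → F :=
  f ⋆[(ContinuousLinearMap.lsmul ℝ ℝ).flip, volume] ρ

theorem mollify_apply (ρ : EuclideanSpace ℝ (Fin n) → ℝ) (f : EuclideanSpace ℝ (Fin n) → F)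
    (x : EuclideanSpace ℝ (Fin n)) : mollify ρ f x = ∫ y, ρ (x - y) • f y := rfl

theorem contDiff_mollify {ρ : EuclideanSpace ℝ (Fin n) → ℝ} (hρ : ContDiff ℝ 1 ρ)
    (hρc : HasCompactSupport ρ) {f : EuclideanSpace ℝ (Fin n) → F} (hf : Integrable f) :
    ContDiff ℝ 1 (mollify ρ f) :=
  hρc.contDiff_convolution_right (n := 1) _ hf.locallyIntegrable hρ

theorem fderiv_mollify_apply {ρ : EuclideanSpace ℝ (Fin n) → ℝ} (hρ : ContDiff ℝ 1 ρ)
    (hρc : HasCompactSupport ρ) {f : EuclideanSpace ℝ (Fin n) → F} (hf : Integrable f)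
    (x e : EuclideanSpace ℝ (Fin n)) :
    fderiv ℝ (mollify ρ f) x e = ∫ y, fderiv ℝ ρ (x - y) e • f y := by
  rw [mollify, (hρc.hasFDerivAt_convolution_right _ hf.locallyIntegrable hρ x).fderiv]
  rw [convolution_def, ContinuousLinearMap.integral_apply]
  · rfl
  · exact (hρc.fderiv ℝ).convolutionExists_right _ hf.locallyIntegrable
      (hρ.continuous_fderiv (by simp)) x

theorem integrable_fderiv_apply_smul {ρ : EuclideanSpace ℝ (Fin n) → ℝ} (hρ : ContDiff ℝ 1 ρ)
    (hρc : HasCompactSupport ρ) {f : EuclideanSpace ℝ (Fin n) → F} (hf : Integrable f)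
    (x e : EuclideanSpace ℝ (Fin n)) :
    Integrable fun y => fderiv ℝ ρ (x - y) e • f y := by
  have h := (hρc.fderiv_apply ℝ e).convolutionExists_right
    (ContinuousLinearMap.lsmul ℝ ℝ (E := F)).flip hf.locallyIntegrable
      ((hρ.continuous_fderiv (by simp)).clm_apply continuous_const) x
  exact h

end Mollify

theorem divergence_mollify {ρ : EuclideanSpace ℝ (Fin n) → ℝ} (hρ : ContDiff ℝ 1 ρ)
    (hρc : HasCompactSupport ρ) {f : EuclideanSpace ℝ (Fin n) → EuclideanSpace ℝ (Fin n)}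
    (hf : Integrable f) (x : EuclideanSpace ℝ (Fin n)) :
    divergence (mollify ρ f) x = ∫ y, fderiv ℝ ρ (x - y) (f y) := by
  simp only [divergence, fderiv_mollify_apply hρ hρc hf]
  have h1 : ∀ i : Fin n, (∫ y, fderiv ℝ ρ (x - y) (EuclideanSpace.single i 1) • f y) i =
      ∫ y, fderiv ℝ ρ (x - y) (EuclideanSpace.single i 1) * f y i := fun i => by
    have := (EuclideanSpace.proj (𝕜 := ℝ) i).integral_comp_comm
      (integrable_fderiv_apply_smul hρ hρc hf x (EuclideanSpace.single i 1))
    simpa using this.symm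
  simp_rw [h1]
  rw [← integral_finsetSum]
  · congr 1 with y
    conv_rhs => rw [← (EuclideanSpace.basisFun (Fin n) ℝ).sum_repr (f y)]
    simp [map_sum, mul_comm]
  · intro i _
    have := (EuclideanSpace.proj (𝕜 := ℝ) i).integrable_comp
      (integrable_fderiv_apply_smul hρ hρc hf x (EuclideanSpace.single i 1))
    simpa using this

/-- An even kernel has odd derivative, so Fubini moves the mollifier from the field onto the
indicator, with the sign of an integration by parts. The field itself only has to be integrable. -/
theorem integral_indicator_mul_divergence_mollify {ρ : EuclideanSpace ℝ (Fin n) → ℝ}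
    (hρ : ContDiff ℝ 1 ρ) (hρc : HasCompactSupport ρ) (hρe : ∀ x, ρ (-x) = ρ x)
    {Ω : Set (EuclideanSpace ℝ (Fin n))} (hΩ : MeasurableSet Ω) (hΩf : volume Ω ≠ ∞)
    {f : EuclideanSpace ℝ (Fin n) → EuclideanSpace ℝ (Fin n)} (hf : Integrable f) :
    ∫ x, Ω.indicator 1 x * divergence (mollify ρ f) x =
      - ∫ y, fderiv ℝ (mollify ρ (Ω.indicator (1 : EuclideanSpace ℝ (Fin n) → ℝ))) y (f y) := by
  have h1 : Integrable (Ω.indicator (1 : EuclideanSpace ℝ (Fin n) → ℝ)) :=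
    (integrable_indicator_iff hΩ).2 (integrableOn_const hΩf)
  have hodd : ∀ x, fderiv ℝ ρ (-x) = - fderiv ℝ ρ x := fun x => by
    have h2 : (fun x => ρ (-x)) = ρ := funext hρe
    have h3 := ((hρ.differentiable (by simp)) (-x)).hasFDerivAt.comp x (hasFDerivAt_id x).neg
    have h4 : ρ ∘ Neg.neg = ρ := h2
    rw [h4] at h3
    rw [h3.fderiv]
    ext; simp
  obtain ⟨M, hM⟩ := (hρc.fderiv ℝ).exists_bound_of_continuous (hρ.continuous_fderiv (by simp))
  have hint : Integrable (Function.uncurry fun x y : EuclideanSpace ℝ (Fin n) =>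
      Ω.indicator (1 : EuclideanSpace ℝ (Fin n) → ℝ) x * fderiv ℝ ρ (x - y) (f y))
      (volume.prod volume) := by
    have hb := (h1.norm.mul_prod hf.norm).const_mul M
    refine hb.mono' ?_ ?_
    · refine AEStronglyMeasurable.mul h1.1.comp_fst ?_
      refine isBoundedBilinearMap_apply.continuous.comp_aestronglyMeasurable
        (AEStronglyMeasurable.prodMk ?_ hf.1.comp_snd)
      exact ((hρ.continuous_fderiv (by simp)).comp
        (continuous_fst.sub continuous_snd)).aestronglyMeasurable
    · refine ae_of_all _ fun p => ?_
      simp only [Function.uncurry, norm_mul]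
      calc _ ≤ ‖Ω.indicator (1 : EuclideanSpace ℝ (Fin n) → ℝ) p.1‖ * (M * ‖f p.2‖) := by
            gcongr
            exact (fderiv ℝ ρ (p.1 - p.2)).le_of_opNorm_le (hM _) _
        _ = _ := by ring
  simp_rw [divergence_mollify hρ hρc hf, ← integral_const_mul]
  rw [integral_integral_swap hint, ← integral_neg]
  congr 1 with y
  rw [fderiv_mollify_apply hρ hρc h1, ← integral_neg]
  congr 1 with x
  rw [← neg_sub, hodd]
  simp [mul_comm]

/-! ### The dual relative isoperimetric inequality -/

theorem norm_mollify_le {F : Type*} [NormedAddCommGroup F] [NormedSpace ℝ F]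
    (φ : ContDiffBump (0 : EuclideanSpace ℝ (Fin n))) {f : EuclideanSpace ℝ (Fin n) → F}
    (hf : ∀ x, ‖f x‖ ≤ 1) (x : EuclideanSpace ℝ (Fin n)) :
    ‖mollify (φ.normed volume) f x‖ ≤ 1 := by
  rw [mollify_apply]
  have hi : Integrable fun y => φ.normed volume (x - y) :=
    (φ.integrable_normed (μ := volume)).comp_sub_left x
  calc _ ≤ ∫ y, φ.normed volume (x - y) := by
        refine norm_integral_le_of_norm_le hi (ae_of_all _ fun y => ?_)
        rw [norm_smul, Real.norm_of_nonneg (φ.nonneg_normed _)]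
        exact mul_le_of_le_one_right (φ.nonneg_normed _) (hf y)
    _ = 1 := by
        rw [integral_sub_left_eq_self (fun y => φ.normed volume y) volume x, φ.integral_normed]

theorem mollify_eq_zero {F : Type*} [NormedAddCommGroup F] [NormedSpace ℝ F]
    (φ : ContDiffBump (0 : EuclideanSpace ℝ (Fin n))) {f : EuclideanSpace ℝ (Fin n) → F}
    {x₀ x : EuclideanSpace ℝ (Fin n)} {r : ℝ} (hf : ∀ y, y ∉ ball x₀ r → f y = 0)
    (hx : x ∉ closedBall x₀ (r + φ.rOut)) :
    mollify (φ.normed volume) f x = 0 := by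
  rw [mollify_apply]
  refine integral_eq_zero_of_ae (ae_of_all _ fun y => ?_)
  by_cases hy : y ∈ ball x₀ r
  · have : x - y ∉ Function.support (φ.normed volume) := by
      rw [φ.support_normed_eq]
      intro h
      apply hx
      rw [mem_closedBall]
      rw [mem_ball] at hy
      rw [mem_ball_zero_iff, ← dist_eq_norm] at h
      linarith [dist_triangle x y x₀]
    simp [Function.notMem_support.1 this]
  · simp [hf y hy]

/-- The field `-∇v / |∇v|` on a set, extended by zero. -/
def unitField (v : EuclideanSpace ℝ (Fin n) → ℝ) (s : Set (EuclideanSpace ℝ (Fin n))) :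
    EuclideanSpace ℝ (Fin n) → EuclideanSpace ℝ (Fin n) :=
  s.indicator fun y => (-‖gradient v y‖⁻¹) • gradient v y

theorem norm_gradient (v : EuclideanSpace ℝ (Fin n) → ℝ) (y : EuclideanSpace ℝ (Fin n)) :
    ‖gradient v y‖ = ‖fderiv ℝ v y‖ := by
  rw [← toDual_gradient, LinearIsometryEquiv.norm_map]

theorem enorm_gradient (v : EuclideanSpace ℝ (Fin n) → ℝ) (y : EuclideanSpace ℝ (Fin n)) :
    ‖gradient v y‖ₑ = ‖fderiv ℝ v y‖ₑ := by
  rw [← ofReal_norm, ← ofReal_norm, norm_gradient]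

theorem norm_unitField_le (v : EuclideanSpace ℝ (Fin n) → ℝ)
    (s : Set (EuclideanSpace ℝ (Fin n))) (y : EuclideanSpace ℝ (Fin n)) :
    ‖unitField v s y‖ ≤ 1 := by
  rw [unitField]
  refine (norm_indicator_le_norm_self _ _).trans ?_
  rw [norm_smul, norm_neg, norm_inv, norm_norm]
  exact inv_mul_le_one

theorem fderiv_unitField (v : EuclideanSpace ℝ (Fin n) → ℝ)
    (s : Set (EuclideanSpace ℝ (Fin n))) (y : EuclideanSpace ℝ (Fin n)) :
    fderiv ℝ v y (unitField v s y) = - s.indicator (fun y => ‖fderiv ℝ v y‖) y := by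
  by_cases hy : y ∈ s
  · rw [unitField, indicator_of_mem hy, indicator_of_mem hy, map_smul, ← inner_gradient_left,
      real_inner_self_eq_norm_sq, ← norm_gradient, smul_eq_mul, neg_mul]
    by_cases h : ‖gradient v y‖ = 0
    · simp [h]
    · field_simp
  · simp [unitField, hy]

theorem integrable_unitField {v : EuclideanSpace ℝ (Fin n) → ℝ} (hv : ContDiff ℝ 1 v)
    {s : Set (EuclideanSpace ℝ (Fin n))} (hs : MeasurableSet s) (hsf : volume s ≠ ∞) :
    Integrable (unitField v s) := by
  have hg : Measurable (gradient v) := by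
    have : Continuous (gradient v) :=
      (InnerProductSpace.toDual ℝ (EuclideanSpace ℝ (Fin n))).symm.continuous.comp
        (hv.continuous_fderiv (by simp))
    exact this.measurable
  have hm : Measurable (unitField v s) := (hg.norm.inv.neg.smul hg).indicator hs
  refine Integrable.mono' (g := s.indicator 1)
    ((integrable_indicator_iff hs).2 (integrableOn_const hsf)) hm.aestronglyMeasurable
    (ae_of_all _ fun y => ?_)
  by_cases hy : y ∈ s
  · simpa [hy] using norm_unitField_le v s y
  · simp [unitField, hy]

/-- Duality without loss: mollifying the unit field with the same kernel that smooths the indicator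
makes the test integral over `Ω` equal to the total variation of the smoothed indicator in the ball.
-/
theorem ofReal_integral_indicator_mul_divergence_mollify_unitField
    (φ : ContDiffBump (0 : EuclideanSpace ℝ (Fin n)))
    {Ω : Set (EuclideanSpace ℝ (Fin n))} (hΩ : MeasurableSet Ω) (hΩf : volume Ω ≠ ∞)
    (x : EuclideanSpace ℝ (Fin n)) (r : ℝ) :
    ENNReal.ofReal (∫ y, Ω.indicator 1 y * divergence (mollify (φ.normed volume)
      (unitField (mollify (φ.normed volume)
        (Ω.indicator (1 : EuclideanSpace ℝ (Fin n) → ℝ))) (ball x r))) y) =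
    ∫⁻ y in ball x r, ‖fderiv ℝ (mollify (φ.normed volume)
        (Ω.indicator (1 : EuclideanSpace ℝ (Fin n) → ℝ))) y‖ₑ := by
  have h1 : Integrable (Ω.indicator (1 : EuclideanSpace ℝ (Fin n) → ℝ)) :=
    (integrable_indicator_iff hΩ).2 (integrableOn_const hΩf)
  have hv := contDiff_mollify (φ.contDiff_normed (μ := volume) (n := 1))
    φ.hasCompactSupport_normed h1
  rw [integral_indicator_mul_divergence_mollify φ.contDiff_normed φ.hasCompactSupport_normed
    φ.normed_neg hΩ hΩf (integrable_unitField hv measurableSet_ball measure_ball_lt_top.ne)]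
  simp_rw [fderiv_unitField]
  rw [integral_neg, neg_neg, integral_indicator measurableSet_ball,
    ofReal_integral_norm_eq_lintegral_enorm]
  exact ((hv.continuous_fderiv (by simp)).locallyIntegrable.integrableOn_isCompact
    (isCompact_closedBall x r)).mono_set ball_subset_closedBall

/-- A dual form of the relative isoperimetric inequality in balls. -/
theorem exists_field_of_volume_pos
    {Ω : Set (EuclideanSpace ℝ (Fin n))} (hΩ : MeasurableSet Ω) (hΩf : volume Ω ≠ ∞)
    {x : EuclideanSpace ℝ (Fin n)} {r : ℝ} (hr : 0 < r)
    (hpos : 0 < volume (Ω ∩ ball x r) * volume (ball x r \ Ω)) :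
    ∃ Φ : EuclideanSpace ℝ (Fin n) → EuclideanSpace ℝ (Fin n), ContDiff ℝ 1 Φ ∧
      (∀ y, ‖Φ y‖ ≤ 1) ∧ (∀ y, y ∉ closedBall x (2 * r) → Φ y = 0) ∧
      volume (Ω ∩ ball x r) * volume (ball x r \ Ω) ≤
        2 * (ENNReal.ofReal (2 * r) * (2 ^ n * volume (ball x r) *
          ENNReal.ofReal (∫ y, Ω.indicator 1 y * divergence Φ y))) := by
  set A := Ω ∩ ball x r with hA
  set D := ball x r \ Ω with hD
  set u : EuclideanSpace ℝ (Fin n) → ℝ := Ω.indicator 1 with hu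
  have hAm : MeasurableSet A := hΩ.inter measurableSet_ball
  have hDm : MeasurableSet D := measurableSet_ball.diff hΩ
  have h1 : Integrable u :=
    (integrable_indicator_iff hΩ).2 (integrableOn_const hΩf)
  have hfin : volume A * volume D ≠ ∞ := ENNReal.mul_ne_top
    ((measure_mono inter_subset_right).trans_lt measure_ball_lt_top).ne
    ((measure_mono sdiff_subset).trans_lt measure_ball_lt_top).ne
  -- Outer radii at most `r` keep the mollified field inside the doubled ball; the fixed ratio 2 of
  -- outer to inner radius gives almost everywhere convergence.
  let φ : ℕ → ContDiffBump (0 : EuclideanSpace ℝ (Fin n)) := fun k =>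
    ⟨r / (k + 1) / 2, r / (k + 1), by positivity, half_lt_self (by positivity)⟩
  have hφ : Tendsto (fun k => (φ k).rOut) atTop (𝓝 0) :=
    tendsto_const_nhds.div_atTop (tendsto_natCast_atTop_atTop.atTop_add tendsto_const_nhds)
  set v : ℕ → EuclideanSpace ℝ (Fin n) → ℝ := fun k => mollify ((φ k).normed volume) u with hvdef
  have hv : ∀ k, ContDiff ℝ 1 (v k) := fun k =>
    contDiff_mollify ((φ k).contDiff_normed (μ := volume) (n := 1))
      (φ k).hasCompactSupport_normed h1
  have hlim : ∀ᵐ y, Tendsto (fun k => v k y) atTop (𝓝 (u y)) := by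
    have := ContDiffBump.ae_convolution_tendsto_right_of_locallyIntegrable (φ := φ) (K := 2)
      (μ := volume) hφ (Eventually.of_forall fun k => by
        show r / (k + 1) ≤ 2 * (r / (k + 1) / 2); linarith) h1.locallyIntegrable
    filter_upwards [this] with y hy
    simp only [hvdef, mollify]
    simp_rw [convolution_flip]
    exact hy
  -- The indicator jumps by one between `A` and `D`, so Fatou bounds the product of volumes by the
  -- limit of the double integrals.
  have hfatou : volume A * volume D ≤
      liminf (fun k => ∫⁻ z in A, ∫⁻ y in D, ‖v k y - v k z‖ₑ) atTop := by
    have hm : ∀ k, Measurable fun p : EuclideanSpace ℝ (Fin n) × EuclideanSpace ℝ (Fin n) =>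
        ‖v k p.2 - v k p.1‖ₑ := fun k => by
      have := (hv k).continuous
      exact (Continuous.enorm (by fun_prop)).measurable
    calc volume A * volume D
        = ∫⁻ z in A, ∫⁻ y in D, 1 := by simp [mul_comm]
      _ ≤ ∫⁻ z in A, ∫⁻ y in D, liminf (fun k => ‖v k y - v k z‖ₑ) atTop := by
          refine lintegral_mono_ae ?_
          filter_upwards [ae_restrict_of_ae hlim, ae_restrict_mem hAm] with z hz hzA
          refine lintegral_mono_ae ?_
          filter_upwards [ae_restrict_of_ae hlim, ae_restrict_mem hDm] with y hy hyD
          rw [((hy.sub hz).enorm).liminf_eq]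
          simp [hu, hyD.2, hzA.1]
      _ ≤ ∫⁻ z in A, liminf (fun k => ∫⁻ y in D, ‖v k y - v k z‖ₑ) atTop :=
          lintegral_mono fun z => lintegral_liminf_le' fun k =>
            ((hm k).comp measurable_prodMk_left).aemeasurable
      _ ≤ _ := lintegral_liminf_le' fun k => (hm k).lintegral_prod_right'.aemeasurable
  -- Giving up a factor 2 makes the inequality strict, so that one fixed `k` suffices; this uses
  -- that the product is positive and finite.
  have hlt : volume A * volume D / 2 <
      liminf (fun k => ∫⁻ z in A, ∫⁻ y in D, ‖v k y - v k z‖ₑ) atTop :=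
    (ENNReal.half_lt_self hpos.ne' hfin).trans_le hfatou
  obtain ⟨k, hk⟩ := (eventually_lt_of_lt_liminf hlt).exists
  refine ⟨mollify ((φ k).normed volume) (unitField (v k) (ball x r)), ?_, ?_, ?_, ?_⟩
  · exact contDiff_mollify ((φ k).contDiff_normed (μ := volume) (n := 1))
      (φ k).hasCompactSupport_normed
      (integrable_unitField (hv k) measurableSet_ball measure_ball_lt_top.ne)
  · exact norm_mollify_le _ (norm_unitField_le _ _)
  · intro y hy
    refine mollify_eq_zero (r := r) _ (fun z hz => indicator_of_notMem hz _) fun h => hy ?_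
    refine closedBall_subset_closedBall ?_ h
    have : r / (k + 1) ≤ r := div_le_self hr.le (by linarith [k.cast_nonneg (α := ℝ)])
    show r + r / (k + 1) ≤ _
    linarith
  · rw [ofReal_integral_indicator_mul_divergence_mollify_unitField _ hΩ hΩf]
    rw [ENNReal.div_lt_iff (by simp) (by simp)] at hk
    refine hk.le.trans ?_
    rw [mul_comm]
    gcongr 2 * ?_
    calc _ ≤ ∫⁻ z in ball x r, ∫⁻ y in ball x r, ‖v k y - v k z‖ₑ := by
          refine (lintegral_mono_set inter_subset_right).trans ?_
          exact lintegral_mono fun z => lintegral_mono_set sdiff_subset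
      _ ≤ _ := by
          refine lintegral_enorm_sub_le (convex_ball x r) measurableSet_ball ?_ (hv k)
          intro y hy z hz
          rw [← dist_eq_norm]
          rw [mem_ball] at hy hz
          linarith [dist_triangle_right y z x]

/-! ### Integrability and linearity of the divergence -/

theorem IsLipc.integrable_fderiv_single
    {Φ : EuclideanSpace ℝ (Fin n) → EuclideanSpace ℝ (Fin n)} (hΦ : IsLipc Φ) (i : Fin n) :
    Integrable fun x => (fderiv ℝ Φ x (EuclideanSpace.single i 1)) i := by
  obtain ⟨⟨L, hL⟩, hc⟩ := hΦ
  have hm : Measurable fun x => (fderiv ℝ Φ x (EuclideanSpace.single i 1)) i :=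
    (EuclideanSpace.proj (𝕜 := ℝ) i).continuous.measurable.comp
      (measurable_fderiv_apply_const ℝ Φ _)
  refine Integrable.mono' (g := (tsupport Φ).indicator fun _ => (L : ℝ))
    ((integrable_indicator_iff (isClosed_tsupport Φ).measurableSet).2
      (integrableOn_const hc.isCompact.measure_lt_top.ne)) hm.aestronglyMeasurable
    (ae_of_all _ fun x => ?_)
  by_cases hx : x ∈ tsupport Φ
  · rw [indicator_of_mem hx]
    refine (PiLp.norm_apply_le _ i).trans ?_
    refine ((fderiv ℝ Φ x).le_of_opNorm_le (norm_fderiv_le_of_lipschitz ℝ hL) _).trans ?_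
    simp
  · have : fderiv ℝ Φ x = 0 := by
      by_contra h
      exact hx (support_fderiv_subset ℝ h)
    simp [this, hx]

theorem IsLipc.integrable_divergence
    {Φ : EuclideanSpace ℝ (Fin n) → EuclideanSpace ℝ (Fin n)} (hΦ : IsLipc Φ) :
    Integrable (divergence Φ) :=
  integrable_finsetSum _ fun i _ => hΦ.integrable_fderiv_single i

theorem integrable_indicator_one_mul {X : Type*} [MeasurableSpace X] {μ : Measure X} {Ω : Set X}
    (hΩ : MeasurableSet Ω) {f : X → ℝ} (hf : Integrable f μ) :
    Integrable (fun y => Ω.indicator 1 y * f y) μ := by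
  refine (hf.indicator hΩ).congr (ae_of_all _ fun y => ?_)
  by_cases hy : y ∈ Ω <;> simp [hy]

theorem divergence_sum_smul {ι : Type*} (F : Finset ι) (c : ι → ℝ)
    {Φ : ι → EuclideanSpace ℝ (Fin n) → EuclideanSpace ℝ (Fin n)}
    (hΦ : ∀ i ∈ F, Differentiable ℝ (Φ i)) (x : EuclideanSpace ℝ (Fin n)) :
    divergence (fun y => ∑ i ∈ F, c i • Φ i y) x = ∑ i ∈ F, c i * divergence (Φ i) x := by
  simp only [divergence]
  rw [fderiv_fun_sum (A := fun i y => c i • Φ i y) fun i hi => ((hΦ i hi) x).const_smul (c i)]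
  have : ∀ i ∈ F, fderiv ℝ (fun y => c i • Φ i y) x = c i • fderiv ℝ (Φ i) x :=
    fun i hi => fderiv_fun_const_smul ((hΦ i hi) x) _
  rw [Finset.sum_congr rfl this]
  simp only [FunLike.coe_sum, Finset.sum_apply, FunLike.coe_smul,
    Pi.smul_apply, WithLp.ofLp_sum, WithLp.ofLp_smul, smul_eq_mul]
  rw [Finset.sum_comm]
  simp_rw [Finset.mul_sum]

/-! ### Balls of intermediate density -/

/-- The volume of the unit ball. -/
def ballVol (n : ℕ) : ℝ := volume.real (ball (0 : EuclideanSpace ℝ (Fin n)) 1)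

theorem ballVol_pos (n : ℕ) : 0 < ballVol n :=
  ENNReal.toReal_pos (measure_ball_pos _ _ one_pos).ne' measure_ball_lt_top.ne

theorem volume_ball_eq (x : EuclideanSpace ℝ (Fin n)) {r : ℝ} (hr : 0 < r) :
    volume (ball x r) = ENNReal.ofReal (r ^ n * ballVol n) := by
  rw [Measure.addHaar_ball_of_pos _ _ hr, ENNReal.ofReal_mul (by positivity), ballVol,
    Measure.real, ENNReal.ofReal_toReal measure_ball_lt_top.ne]
  simp

/-- A stopping argument on dyadic radii: small balls lie in `Ω`, large ones are mostly outside. At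
the first scale where the density is at most one half, the previous scale still has density above
one half, and doubling the radius costs only `2 ^ n`. -/
theorem exists_radius_density (hn : n ≠ 0) {Ω : Set (EuclideanSpace ℝ (Fin n))} (hΩ : IsOpen Ω)
    {x₀ : EuclideanSpace ℝ (Fin n)} {R : ℝ} (hR : Ω ⊆ ball x₀ R)
    {x : EuclideanSpace ℝ (Fin n)} (hx : x ∈ Ω) :
    ∃ r : ℝ, 0 < r ∧ r ≤ 4 * R ∧
      volume (ball x r) ≤ 2 ^ (n + 1) * volume (Ω ∩ ball x r) ∧
      volume (ball x r) ≤ 2 * volume (ball x r \ Ω) := by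
  have hR0 : 0 < R := dist_nonneg.trans_lt (hR hx)
  obtain ⟨r₀, hr₀, hball⟩ := Metric.isOpen_iff.1 hΩ x hx
  have hω := ballVol_pos n
  have hex : ∃ k : ℕ, 2 * volume (Ω ∩ ball x (2 ^ k * r₀)) ≤ volume (ball x (2 ^ k * r₀)) := by
    obtain ⟨k, hk⟩ := pow_unbounded_of_one_lt (2 * R / r₀) (one_lt_two (α := ℝ))
    refine ⟨k, ?_⟩
    calc 2 * volume (Ω ∩ ball x (2 ^ k * r₀)) ≤ 2 * volume (ball x₀ R) := by
          gcongr; exact inter_subset_left.trans hR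
      _ ≤ volume (ball x (2 ^ k * r₀)) := by
          rw [volume_ball_eq _ hR0, volume_ball_eq _ (by positivity),
            ← ENNReal.ofReal_ofNat 2, ← ENNReal.ofReal_mul (by norm_num), ← mul_assoc]
          gcongr
          rw [div_lt_iff₀ hr₀] at hk
          calc 2 * R ^ n ≤ 2 ^ n * R ^ n := by
                gcongr; exact le_self_pow₀ (by norm_num) hn
            _ = (2 * R) ^ n := (mul_pow _ _ _).symm
            _ ≤ _ := by gcongr
  classical
  set k := Nat.find hex with hkdef
  have hk := Nat.find_spec hex
  rw [← hkdef] at hk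
  have hk0 : k ≠ 0 := by
    intro h0
    rw [h0, pow_zero, one_mul, inter_eq_self_of_subset_right hball] at hk
    have h1 : volume (ball x r₀) ≠ 0 := (measure_ball_pos _ _ hr₀).ne'
    have h2 : volume (ball x r₀) ≠ ∞ := measure_ball_lt_top.ne
    have h3 : (2 : ℝ≥0∞) * volume (ball x r₀) ≤ 1 * volume (ball x r₀) := by simpa using hk
    rw [ENNReal.mul_le_mul_iff_left h1 h2] at h3
    norm_num at h3
  obtain ⟨m, hm⟩ := Nat.exists_eq_succ_of_ne_zero hk0
  have hmlt := Nat.find_min hex (m := m) (by omega)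
  rw [not_le] at hmlt
  set r := 2 ^ k * r₀ with hr
  have hrpos : 0 < r := by positivity
  have hrm : r = 2 * (2 ^ m * r₀) := by rw [hr, hm, pow_succ]; ring
  have hA : volume (ball x r) ≤ 2 ^ (n + 1) * volume (Ω ∩ ball x r) := by
    calc volume (ball x r) = 2 ^ n * volume (ball x (2 ^ m * r₀)) := by
          rw [volume_ball_eq _ hrpos, volume_ball_eq _ (by positivity), hrm, mul_pow, mul_assoc,
            ENNReal.ofReal_mul (by positivity), ENNReal.ofReal_pow (by norm_num)]
          simp
      _ ≤ 2 ^ n * (2 * volume (Ω ∩ ball x (2 ^ m * r₀))) := by gcongr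
      _ = 2 ^ (n + 1) * volume (Ω ∩ ball x (2 ^ m * r₀)) := by rw [pow_succ, mul_assoc]
      _ ≤ _ := by
          have : 0 < 2 ^ m * r₀ := by positivity
          gcongr
          linarith
  refine ⟨r, hrpos, ?_, hA, ?_⟩
  -- The density bound forces `r ^ n ≤ 2 ^ (n + 1) * R ^ n`, and `2 ^ (n + 1) ≤ 4 ^ n`. The Vitali
  -- selection needs this uniform bound.
  · have h1 : volume (ball x r) ≤ 2 ^ (n + 1) * volume (ball x₀ R) :=
      hA.trans (by gcongr; exact inter_subset_left.trans hR)
    rw [volume_ball_eq _ hR0, volume_ball_eq _ hrpos, ← ENNReal.ofReal_ofNat 2,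
      ← ENNReal.ofReal_pow (by norm_num), ← ENNReal.ofReal_mul (by positivity), ← mul_assoc,
      ENNReal.ofReal_le_ofReal_iff (by positivity)] at h1
    replace h1 := le_of_mul_le_mul_right h1 hω
    refine le_of_pow_le_pow_left₀ hn (by positivity) (h1.trans ?_)
    rw [mul_pow]
    gcongr
    calc (2 : ℝ) ^ (n + 1) ≤ 2 ^ (n + n) := by
          gcongr
          · norm_num
          · omega
      _ = 4 ^ n := by rw [pow_add, ← mul_pow]; norm_num
  · have h1 := measure_inter_add_sdiff (μ := volume) (ball x r) hΩ.measurableSet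
    rw [inter_comm] at h1
    have h2 : volume (ball x r) + volume (ball x r) ≤
        volume (ball x r) + 2 * volume (ball x r \ Ω) := by
      calc _ = 2 * volume (Ω ∩ ball x r) + 2 * volume (ball x r \ Ω) := by
            rw [← mul_add, h1, two_mul]
        _ ≤ _ := by gcongr
    exact (ENNReal.add_le_add_iff_left measure_ball_lt_top.ne).1 h2

theorem exists_radius_field (hn : n ≠ 0) {Ω : Set (EuclideanSpace ℝ (Fin n))} (hΩ : IsOpen Ω)
    {x₀ : EuclideanSpace ℝ (Fin n)} {R : ℝ} (hR : Ω ⊆ ball x₀ R)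
    {x : EuclideanSpace ℝ (Fin n)} (hx : x ∈ Ω) :
    ∃ r : ℝ, 0 < r ∧ r ≤ 4 * R ∧
      ∃ Φ : EuclideanSpace ℝ (Fin n) → EuclideanSpace ℝ (Fin n), ContDiff ℝ 1 Φ ∧
      (∀ y, ‖Φ y‖ ≤ 1) ∧ (∀ y, y ∉ closedBall x (2 * r) → Φ y = 0) ∧
      r ^ (n - 1) * ballVol n ≤
        2 ^ (2 * n + 4) * ∫ y, Ω.indicator 1 y * divergence Φ y := by
  obtain ⟨r, hr, hrR, hA, hD⟩ := exists_radius_density hn hΩ hR hx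
  have hV0 : volume (ball x r) ≠ 0 := (measure_ball_pos _ _ hr).ne'
  have hVt : volume (ball x r) ≠ ∞ := measure_ball_lt_top.ne
  have hpos : 0 < volume (Ω ∩ ball x r) * volume (ball x r \ Ω) := by
    rw [pos_iff_ne_zero]
    intro h
    rcases mul_eq_zero.1 h with h | h
    · rw [h, mul_zero] at hA; exact hV0 (le_zero_iff.1 hA)
    · rw [h, mul_zero] at hD; exact hV0 (le_zero_iff.1 hD)
  obtain ⟨Φ, hΦ, hΦ1, hΦ0, h⟩ := exists_field_of_volume_pos hΩ.measurableSet
    ((measure_mono hR).trans_lt measure_ball_lt_top).ne hr hpos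
  refine ⟨r, hr, hrR, Φ, hΦ, hΦ1, hΦ0, ?_⟩
  set J := ∫ y, Ω.indicator 1 y * divergence Φ y with hJ
  -- The power `2 n + 4` collects `2 ^ (n + 1)` and 2 from the densities, two factors 2 from the
  -- dual inequality and its diameter, and `2 ^ n` from Poincaré.
  have h1 : volume (ball x r) * volume (ball x r) ≤
      (ENNReal.ofReal (2 ^ (2 * n + 4) * r) * ENNReal.ofReal J) * volume (ball x r) := by
    calc volume (ball x r) * volume (ball x r)
        ≤ (2 ^ (n + 1) * volume (Ω ∩ ball x r)) * (2 * volume (ball x r \ Ω)) :=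
          mul_le_mul' hA hD
      _ = 2 ^ (n + 1) * 2 * (volume (Ω ∩ ball x r) * volume (ball x r \ Ω)) := by ring
      _ ≤ 2 ^ (n + 1) * 2 * (2 * (ENNReal.ofReal (2 * r) * (2 ^ n * volume (ball x r) *
          ENNReal.ofReal J))) := by gcongr
      _ = _ := by
          rw [ENNReal.ofReal_mul (by norm_num), ENNReal.ofReal_mul (by positivity),
            ENNReal.ofReal_pow (by norm_num), ENNReal.ofReal_ofNat]
          ring
  rw [ENNReal.mul_le_mul_iff_left hV0 hVt, ← ENNReal.ofReal_mul (by positivity),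
    volume_ball_eq _ hr] at h1
  have hω := ballVol_pos n
  have h2 := ENNReal.ofReal_le_ofReal_iff'.1 h1
  rcases h2 with h2 | h2
  · have h3 : r ^ n = r * r ^ (n - 1) := by
      rw [← pow_succ']; congr 1; omega
    rw [h3] at h2
    refine le_of_mul_le_mul_left ?_ hr
    calc _ = r * r ^ (n - 1) * ballVol n := by ring
      _ ≤ _ := h2
      _ = _ := by ring
  · exact absurd h2 (not_le.2 (by positivity))

/-! ### The isoperimetric inequality -/

theorem rpow_sum_le_sum_rpow {ι : Type*} (F : Finset ι) (a : ι → ℝ≥0∞) {p : ℝ} (hp : 0 < p)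
    (hp1 : p ≤ 1) : (∑ i ∈ F, a i) ^ p ≤ ∑ i ∈ F, a i ^ p := by
  classical
  induction F using Finset.induction_on with
  | empty => simp [hp]
  | insert i F hi ih =>
    rw [Finset.sum_insert hi, Finset.sum_insert hi]
    exact (ENNReal.rpow_add_le_add_rpow _ _ hp.le hp1).trans (by gcongr)

/-- A single radius in the supremum suffices. The choice of `α` makes the radial factor `ρ ^ (α - n)
= ρ ^ (-q (n - 1))`, whose `q`-th root no longer depends on `q`. -/
theorem le_fracMaximal_rpow {q α : ℝ} (hq : 0 < q) (hα : α = (n : ℝ) - q * ((n : ℝ) - 1))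
    {μ : Measure (EuclideanSpace ℝ (Fin n))} {y : EuclideanSpace ℝ (Fin n)} {ρ m : ℝ}
    (hρ : 0 < ρ) (hm : 0 ≤ m) (h : ENNReal.ofReal m ≤ μ (ball y ρ)) :
    ENNReal.ofReal (ρ ^ (-((n : ℝ) - 1)) * (m / ballVol n) ^ (1 / q)) ≤
      fracMaximal α μ y ^ (1 / q) := by
  have hω := ballVol_pos n
  have h1 : ENNReal.ofReal (ρ ^ (-((n : ℝ) - 1) * q) * (m / ballVol n)) ≤ fracMaximal α μ y := by
    refine le_trans ?_ (le_iSup₂ (f := fun (r : ℝ) (_ : 0 < r) =>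
      ENNReal.ofReal (r ^ α) * (μ (ball y r) / volume (ball y r))) ρ hρ)
    calc _ = ENNReal.ofReal (ρ ^ α) * (ENNReal.ofReal m / volume (ball y ρ)) := by
          rw [volume_ball_eq _ hρ, ← ENNReal.ofReal_div_of_pos (by positivity),
            ← ENNReal.ofReal_mul (by positivity), hα]
          congr 1
          rw [show -((n : ℝ) - 1) * q = (n - q * ((n : ℝ) - 1)) - n by ring, Real.rpow_sub hρ,
            Real.rpow_natCast]
          field_simp
      _ ≤ _ := by gcongr
  refine le_trans (le_of_eq ?_) (ENNReal.rpow_le_rpow h1 (by positivity : 0 ≤ 1 / q))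
  rw [ENNReal.ofReal_rpow_of_nonneg (by positivity) (by positivity),
    Real.mul_rpow (by positivity) (by positivity), ← Real.rpow_mul hρ.le]
  congr 3
  field_simp

/-- A constant for the isoperimetric inequality. -/
def isoConst (n : ℕ) : ℝ := 2 ^ (2 * n + 4) * 13 ^ ((n : ℝ) - 1) / min 1 (ballVol n)

theorem isoConst_nonneg (n : ℕ) : 0 ≤ isoConst n := by
  have := ballVol_pos n
  rw [isoConst]; positivity

/-- The right side is `ω ^ (1 - 1 / q)` with exponent in `[0, 1)`; this bound removes `q` from the
constants. -/
theorem min_one_le_mul_rpow {ω q : ℝ} (hω : 0 < ω) (hq : 1 ≤ q) :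
    min 1 ω ≤ ω * ω⁻¹ ^ (1 / q) := by
  have hq0 : 0 < 1 / q := by positivity
  have hq1 : 1 / q ≤ 1 := by rw [div_le_one (by linarith)]; exact hq
  rcases le_total 1 ω with h | h
  · rw [min_eq_left h]
    calc 1 = ω * ω⁻¹ := by field_simp
      _ = ω * ω⁻¹ ^ (1 : ℝ) := by rw [Real.rpow_one]
      _ ≤ _ := mul_le_mul_of_nonneg_left
          (Real.rpow_le_rpow_of_exponent_ge (by positivity) (inv_le_one_of_one_le₀ h) hq1) hω.le
  · rw [min_eq_right h]
    exact le_mul_of_one_le_right hω.le (Real.one_le_rpow ((one_le_inv₀ hω).2 h) hq0.le)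

/-- The gain `r ^ (n - 1)` of the field cancels the decay `r ^ (-(n - 1))` of the weight, leaving a
scale-free bound for one ball. -/
theorem rpow_le_isoConst_mul (hn : n ≠ 0) {q M r J : ℝ} (hq : 1 ≤ q) (hM : 0 ≤ M) (hr : 0 < r)
    (hJ : r ^ (n - 1) * ballVol n ≤ 2 ^ (2 * n + 4) * J) :
    M ^ (1 / q) ≤ isoConst n *
      ((13 * r) ^ (-((n : ℝ) - 1)) * (M / ballVol n) ^ (1 / q) * J) := by
  have hω := ballVol_pos n
  have hmin : 0 < min 1 (ballVol n) := by positivity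
  have hJ' : r ^ ((n : ℝ) - 1) * ballVol n ≤ 2 ^ (2 * n + 4) * J := by
    rw [← Real.rpow_natCast, Nat.cast_pred (Nat.pos_of_ne_zero hn)] at hJ
    exact hJ
  have h13 : (13 : ℝ) ^ ((n : ℝ) - 1) * (13 * r) ^ (-((n : ℝ) - 1)) = (r ^ ((n : ℝ) - 1))⁻¹ := by
    rw [Real.mul_rpow (by norm_num) hr.le, Real.rpow_neg (by norm_num), Real.rpow_neg hr.le]
    field_simp
  have hrn : 0 < r ^ ((n : ℝ) - 1) := by positivity
  calc M ^ (1 / q) ≤ (ballVol n * (ballVol n)⁻¹ ^ (1 / q) / min 1 (ballVol n)) * M ^ (1 / q) :=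
        le_mul_of_one_le_left (by positivity)
          ((one_le_div hmin).2 (min_one_le_mul_rpow hω hq))
    _ = (r ^ ((n : ℝ) - 1))⁻¹ * (M / ballVol n) ^ (1 / q) / min 1 (ballVol n) *
          (r ^ ((n : ℝ) - 1) * ballVol n) := by
        rw [div_eq_mul_inv M, Real.mul_rpow hM (by positivity)]
        field_simp
    _ ≤ (r ^ ((n : ℝ) - 1))⁻¹ * (M / ballVol n) ^ (1 / q) / min 1 (ballVol n) *
          (2 ^ (2 * n + 4) * J) := by
        gcongr
    _ = _ := by
        rw [← h13, isoConst]
        ring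

theorem isLipc_of_contDiff {Φ : EuclideanSpace ℝ (Fin n) → EuclideanSpace ℝ (Fin n)}
    (hΦ : ContDiff ℝ 1 Φ) {x : EuclideanSpace ℝ (Fin n)} {r : ℝ}
    (h0 : ∀ y, y ∉ closedBall x r → Φ y = 0) : IsLipc Φ := by
  have hc : HasCompactSupport Φ := HasCompactSupport.intro (isCompact_closedBall x r)
    fun y hy => h0 y hy
  exact ⟨hΦ.lipschitzWith_of_hasCompactSupport hc (by simp), hc⟩

/-- A weighted sum of disjointly supported fields is admissible for the weighted perimeter. -/
theorem ofReal_sum_le_weightedPer {ι : Type*} (F : Finset ι) {c : ι → ℝ} (hc : ∀ i, 0 ≤ c i)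
    {Φ : ι → EuclideanSpace ℝ (Fin n) → EuclideanSpace ℝ (Fin n)}
    {x : ι → EuclideanSpace ℝ (Fin n)} {r : ι → ℝ}
    (hΦ : ∀ i, ContDiff ℝ 1 (Φ i)) (hΦ1 : ∀ i y, ‖Φ i y‖ ≤ 1)
    (hΦ0 : ∀ i y, y ∉ closedBall (x i) (r i) → Φ i y = 0)
    (hdisj : ∀ i ∈ F, ∀ j ∈ F, i ≠ j → Disjoint (closedBall (x i) (r i)) (closedBall (x j) (r j)))
    {w : EuclideanSpace ℝ (Fin n) → ℝ≥0∞}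
    (hw : ∀ i ∈ F, ∀ y ∈ closedBall (x i) (r i), ENNReal.ofReal (c i) ≤ w y)
    {Ω : Set (EuclideanSpace ℝ (Fin n))} (hΩ : MeasurableSet Ω) :
    ENNReal.ofReal (∑ i ∈ F, c i * ∫ y, Ω.indicator 1 y * divergence (Φ i) y) ≤
      weightedPer Ω w := by
  have hlip : ∀ i, IsLipc (Φ i) := fun i => isLipc_of_contDiff (hΦ i) (hΦ0 i)
  set Ψ : EuclideanSpace ℝ (Fin n) → EuclideanSpace ℝ (Fin n) := fun y => ∑ i ∈ F, c i • Φ i y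
    with hΨ
  have hΨd : ContDiff ℝ 1 Ψ := ContDiff.sum fun i _ => (hΦ i).const_smul (c i)
  have hΨc : HasCompactSupport Ψ := by
    refine HasCompactSupport.intro (K := ⋃ i ∈ F, closedBall (x i) (r i))
      (F.isCompact_biUnion fun i _ => isCompact_closedBall _ _) fun y hy => ?_
    refine Finset.sum_eq_zero fun i hi => ?_
    rw [hΦ0 i y fun h => hy (mem_biUnion hi h), smul_zero]
  have hΨw : ∀ y, ‖Ψ y‖ₑ ≤ w y := by
    intro y
    by_cases hy : ∃ i ∈ F, y ∈ closedBall (x i) (r i)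
    · obtain ⟨i, hi, hyi⟩ := hy
      have : Ψ y = c i • Φ i y := by
        refine Finset.sum_eq_single_of_mem i hi fun j hj hji => ?_
        rw [hΦ0 j y (disjoint_left.1 (hdisj i hi j hj hji.symm) hyi), smul_zero]
      refine le_trans ?_ (hw i hi y hyi)
      rw [this, ← ofReal_norm]
      apply ENNReal.ofReal_le_ofReal
      rw [norm_smul, Real.norm_of_nonneg (hc i)]
      exact mul_le_of_le_one_right (hc i) (hΦ1 i y)
    · have : Ψ y = 0 := Finset.sum_eq_zero fun i hi => by
        rw [hΦ0 i y fun h => hy ⟨i, hi, h⟩, smul_zero]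
      simp [this]
  refine le_trans (le_of_eq ?_) (le_iSup₂ (f := fun
    (Φ : EuclideanSpace ℝ (Fin n) → EuclideanSpace ℝ (Fin n))
    (_ : IsLipc Φ ∧ ∀ x, ‖Φ x‖ₑ ≤ w x) =>
      ENNReal.ofReal (∫ x, Ω.indicator 1 x * divergence Φ x)) Ψ
      ⟨⟨hΨd.lipschitzWith_of_hasCompactSupport hΨc (by simp), hΨc⟩, hΨw⟩)
  congr 1
  have h1 : ∀ y, Ω.indicator 1 y * divergence Ψ y =
      ∑ i ∈ F, c i * (Ω.indicator 1 y * divergence (Φ i) y) := fun y => by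
    rw [hΨ, divergence_sum_smul F c fun i _ => (hΦ i).differentiable (by simp), Finset.mul_sum]
    exact Finset.sum_congr rfl fun i _ => by ring
  simp_rw [h1]
  rw [integral_finsetSum _ fun i _ =>
    (integrable_indicator_one_mul hΩ (hlip i).integrable_divergence).const_mul _]
  simp_rw [integral_const_mul]

theorem measure_rpow_le_weightedPer (hn : n ≠ 0) {q α : ℝ} (hq : 1 ≤ q)
    (hα : α = (n : ℝ) - q * ((n : ℝ) - 1)) (μ : Measure (EuclideanSpace ℝ (Fin n)))
    [IsLocallyFiniteMeasure μ] {Ω : Set (EuclideanSpace ℝ (Fin n))} (hΩ : IsOpen Ω)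
    (hb : Bornology.IsBounded Ω) :
    μ Ω ^ (1 / q) ≤ ENNReal.ofReal (isoConst n) *
      weightedPer Ω (fun x => fracMaximal α μ x ^ (1 / q)) := by
  have hω := ballVol_pos n
  have hq0 : 0 < q := by linarith
  have hq1 : 1 / q ≤ 1 := by rw [div_le_one hq0]; exact hq
  obtain ⟨R, hR⟩ := hb.subset_ball 0
  choose r hr hrR Φ hΦ hΦ1 hΦ0 hΦJ using fun x : Ω => exists_radius_field hn hΩ hR x.2
  -- The selection uses radii `2 r`, the supports of the fields; the enlarged balls covering `Ω`
  -- have radius `10 r`.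
  obtain ⟨u, -, hu, hcov⟩ := Vitali.exists_disjoint_subfamily_covering_enlargement_closedBall
    (univ : Set Ω) (fun x => (x : EuclideanSpace ℝ (Fin n))) (fun x => 2 * r x) (2 * (4 * R))
    (fun x _ => by have := hrR x; linarith) 5 (by norm_num)
  have hucount : u.Countable := hu.countable_of_nonempty_interior fun x _ => by
    rw [interior_closedBall _ (by have := hr x; positivity)]
    exact nonempty_ball.2 (by have := hr x; positivity)
  set P := weightedPer Ω (fun x => fracMaximal α μ x ^ (1 / q))
  set m : Ω → ℝ≥0∞ := fun x => μ (closedBall x (5 * (2 * r x)))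
  have hm : ∀ x, m x ≠ ∞ := fun x => measure_closedBall_lt_top.ne
  have hcover : μ Ω ≤ ∑' x : u, m x := by
    have : Countable u := hucount.to_subtype
    refine (measure_mono fun x hx => ?_).trans (measure_iUnion_le _)
    obtain ⟨b, hb, hsub⟩ := hcov ⟨x, hx⟩ (mem_univ _)
    exact mem_iUnion.2 ⟨⟨b, hb⟩, hsub (mem_closedBall_self (by have := hr ⟨x, hx⟩; positivity))⟩
  have key : ∀ F : Finset u, ∑ x ∈ F, m x ^ (1 / q) ≤ ENNReal.ofReal (isoConst n) * P := by
    intro F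
    -- A lower bound for the weight on the ball of radius `2 r`: seen from any of its points, the
    -- ball of radius `10 r` lies within distance `12 r`, hence in the open ball of radius `13 r`.
    set c : u → ℝ := fun x => (13 * r x) ^ (-((n : ℝ) - 1)) *
      ((m x).toReal / ballVol n) ^ (1 / q) with hc
    have hc0 : ∀ x, 0 ≤ c x := fun x => by have := hr x; positivity
    have h1 := ofReal_sum_le_weightedPer F hc0 (Φ := fun x : u => Φ x)
      (x := fun x : u => (x : EuclideanSpace ℝ (Fin n))) (r := fun x : u => 2 * r x)
      (fun x => hΦ x) (fun x => hΦ1 x) (fun x => hΦ0 x)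
      (fun x _ y _ hxy => hu x.2 y.2 fun h => hxy (Subtype.ext h))
      (w := fun x => fracMaximal α μ x ^ (1 / q))
      (fun x _ y hy => by
        refine le_fracMaximal_rpow hq0 hα (by have := hr x; positivity) ENNReal.toReal_nonneg ?_
        rw [ENNReal.ofReal_toReal (hm x)]
        refine measure_mono fun z hz => ?_
        rw [mem_closedBall] at hy hz
        rw [mem_ball]
        have := hr x
        linarith [dist_triangle_right z y (x : EuclideanSpace ℝ (Fin n))]) hΩ.measurableSet
    refine le_trans ?_ (mul_le_mul_right h1 _)
    rw [← ENNReal.ofReal_mul (isoConst_nonneg n), Finset.mul_sum, ENNReal.ofReal_sum_of_nonneg]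
    · refine Finset.sum_le_sum fun x _ => ?_
      rw [← ENNReal.ofReal_toReal (hm x), ENNReal.ofReal_rpow_of_nonneg (by positivity)
        (by positivity)]
      exact ENNReal.ofReal_le_ofReal (rpow_le_isoConst_mul hn hq (by simp) (hr x) (hΦJ x))
    · exact fun x _ => (Real.rpow_nonneg ENNReal.toReal_nonneg _).trans
        (rpow_le_isoConst_mul (M := (m x).toReal) hn hq (by simp) (hr x) (hΦJ x))
  refine le_trans (ENNReal.rpow_le_rpow hcover (by positivity)) ?_
  -- Only finite sums of fields are tested, so the series of masses is reached as a supremum over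
  -- finite subfamilies.
  rw [ENNReal.tsum_eq_iSup_sum, one_div, ENNReal.rpow_inv_le_iff hq0]
  refine iSup_le fun F => ?_
  rw [← ENNReal.rpow_inv_le_iff hq0, ← one_div]
  exact (rpow_sum_le_sum_rpow F _ (by positivity) hq1).trans (key F)

/-! ### Truncations and half of the coarea formula -/

theorem IsLipc.ofReal_integral_mul_divergence_le {z : EuclideanSpace ℝ (Fin n) → ℝ}
    (hz : IsLipc z) {Φ : EuclideanSpace ℝ (Fin n) → EuclideanSpace ℝ (Fin n)} (hΦ : IsLipc Φ) :
    ENNReal.ofReal (∫ x, z x * divergence Φ x) ≤ ∫⁻ x, ‖gradient z x‖ₑ * ‖Φ x‖ₑ := by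
  obtain ⟨⟨L, hL⟩, hzc⟩ := hz
  have hΦ' := hΦ
  obtain ⟨⟨D, hD⟩, hΦc⟩ := hΦ'
  have hcomp : ∀ i, LipschitzWith (1 * D) fun x => Φ x i := fun i =>
    LipschitzWith.comp (f := fun v : EuclideanSpace ℝ (Fin n) => v i)
      (LipschitzWith.of_dist_le_mul fun x y => by
        simpa [dist_eq_norm] using PiLp.norm_apply_le (x - y) i) hD
  have hcompc : ∀ i, HasCompactSupport fun x => Φ x i := fun i =>
    hΦc.comp_left (g := fun v : EuclideanSpace ℝ (Fin n) => v i) rfl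
  obtain ⟨M, hM⟩ := hL.continuous.bounded_above_of_compact_support hzc
  have hIBP : ∀ i, ∫ x, fderiv ℝ z x (EuclideanSpace.single i 1) * Φ x i =
      - ∫ x, z x * (fderiv ℝ Φ x (EuclideanSpace.single i 1)) i := by
    intro i
    have h := LipschitzWith.integral_lineDeriv_mul_eq (μ := volume) hL (hcomp i) (hcompc i)
      (EuclideanSpace.single i (1 : ℝ))
    rw [← integral_neg]
    refine Eq.trans ?_ (h.trans ?_)
    · refine integral_congr_ae ?_
      filter_upwards [hL.ae_differentiableAt (μ := volume)] with x hx
      rw [hx.lineDeriv_eq_fderiv]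
    · refine integral_congr_ae ?_
      filter_upwards [hD.ae_differentiableAt (μ := volume)] with x hx
      have hd : HasFDerivAt (fun x => Φ x i)
          ((EuclideanSpace.proj (𝕜 := ℝ) i).comp (fderiv ℝ Φ x)) x :=
        (EuclideanSpace.proj (𝕜 := ℝ) i).hasFDerivAt.comp x hx.hasFDerivAt
      rw [hd.differentiableAt.lineDeriv_eq_fderiv, hd.fderiv]
      simp [mul_comm]
  have hi1 : ∀ i : Fin n, Integrable fun x => z x * (fderiv ℝ Φ x (EuclideanSpace.single i 1)) i :=
    fun i => (hΦ.integrable_fderiv_single i).bdd_mul hL.continuous.aestronglyMeasurable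
      (ae_of_all _ hM)
  have hi2 : ∀ i : Fin n, Integrable fun x => fderiv ℝ z x (EuclideanSpace.single i 1) * Φ x i :=
    fun i => ((hcomp i).continuous.integrable_of_hasCompactSupport (hcompc i)).bdd_mul (c := L)
      (measurable_fderiv_apply_const ℝ z _).aestronglyMeasurable (ae_of_all _ fun x => by
        refine ((fderiv ℝ z x).le_of_opNorm_le (norm_fderiv_le_of_lipschitz ℝ hL) _).trans ?_
        simp)
  have hsum : ∫ x, z x * divergence Φ x = - ∫ x, fderiv ℝ z x (Φ x) := by
    have h1 : ∀ x, fderiv ℝ z x (Φ x) =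
        ∑ i, fderiv ℝ z x (EuclideanSpace.single i 1) * Φ x i := fun x => by
      conv_lhs => rw [← (EuclideanSpace.basisFun (Fin n) ℝ).sum_repr (Φ x)]
      simp [map_sum, mul_comm]
    simp_rw [h1, divergence, Finset.mul_sum]
    rw [integral_finsetSum _ fun i _ => hi1 i, integral_finsetSum _ fun i _ => hi2 i,
      Finset.sum_congr rfl fun i _ => hIBP i]
    simp
  rw [hsum]
  refine (Real.ofReal_le_enorm _).trans ?_
  rw [enorm_neg]
  refine (enorm_integral_le_lintegral_enorm _).trans (lintegral_mono fun x => ?_)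
  rw [enorm_gradient]
  exact (fderiv ℝ z x).le_opENorm _

/-- The truncation of `|u|` between the levels `t` and `t + h`, rescaled to `[0, 1]`. -/
def ramp (t h : ℝ) (u : EuclideanSpace ℝ (Fin n) → ℝ) (x : EuclideanSpace ℝ (Fin n)) : ℝ :=
  max 0 (min 1 ((|u x| - t) / h))

theorem ramp_nonneg (t h : ℝ) (u : EuclideanSpace ℝ (Fin n) → ℝ) (x : EuclideanSpace ℝ (Fin n)) :
    0 ≤ ramp t h u x := le_max_left _ _

theorem ramp_le_one (t h : ℝ) (u : EuclideanSpace ℝ (Fin n) → ℝ) (x : EuclideanSpace ℝ (Fin n)) :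
    ramp t h u x ≤ 1 := max_le zero_le_one (min_le_left _ _)

theorem ramp_eq_zero {t h : ℝ} (hh : 0 < h) {u : EuclideanSpace ℝ (Fin n) → ℝ}
    {x : EuclideanSpace ℝ (Fin n)} (hx : |u x| ≤ t) : ramp t h u x = 0 :=
  max_eq_left ((min_le_right _ _).trans (div_nonpos_of_nonpos_of_nonneg (by linarith) hh.le))

theorem ramp_eq_one {t h : ℝ} (hh : 0 < h) {u : EuclideanSpace ℝ (Fin n) → ℝ}
    {x : EuclideanSpace ℝ (Fin n)} (hx : t + h ≤ |u x|) : ramp t h u x = 1 := by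
  have : 1 ≤ (|u x| - t) / h := by rw [one_le_div hh]; linarith
  rw [ramp, min_eq_left this, max_eq_right zero_le_one]

theorem ramp_eq_div {t h : ℝ} (hh : 0 < h) {u : EuclideanSpace ℝ (Fin n) → ℝ}
    {x : EuclideanSpace ℝ (Fin n)} (h1 : t < |u x|) (h2 : |u x| < t + h) :
    ramp t h u x = (|u x| - t) / h := by
  have h3 : (|u x| - t) / h ≤ 1 := by rw [div_le_one hh]; linarith
  have h4 : 0 ≤ (|u x| - t) / h := div_nonneg (by linarith) hh.le
  rw [ramp, min_eq_right h3, max_eq_right h4]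

theorem IsLipc.ramp {u : EuclideanSpace ℝ (Fin n) → ℝ} (hu : IsLipc u) {t h : ℝ} (ht : 0 ≤ t)
    (hh : 0 < h) : IsLipc (ramp t h u) := by
  obtain ⟨⟨L, hL⟩, hc⟩ := hu
  constructor
  · have h1 : LipschitzWith (1 * L) fun x => |u x| := lipschitzWith_one_norm.comp hL
    have h2 : LipschitzWith (Real.toNNReal h⁻¹) fun s : ℝ => (s - t) / h :=
      LipschitzWith.of_dist_le_mul fun a b => by
        rw [Real.dist_eq, Real.dist_eq, Real.coe_toNNReal _ (by positivity), ← sub_div, abs_div,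
          abs_of_pos hh, div_eq_inv_mul]
        apply le_of_eq; congr 2; ring
    exact ⟨_, ((h2.comp h1).const_min 1).const_max 0⟩
  · refine hc.mono fun x hx => ?_
    contrapose! hx
    rw [Function.notMem_support] at hx ⊢
    exact ramp_eq_zero hh (by simpa [hx] using ht)

/-- Outside the open band the ramp attains its global minimum 0 or maximum 1, so its derivative
vanishes there, even on the boundary levels. Inside, it is locally an affine function of `u` with
slope `± 1 / h`. -/
theorem enorm_gradient_ramp_le {u : EuclideanSpace ℝ (Fin n) → ℝ} (hu : Continuous u) {t h : ℝ}
    (ht : 0 ≤ t) (hh : 0 < h) (x : EuclideanSpace ℝ (Fin n)) :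
    ‖gradient (ramp t h u) x‖ₑ ≤ ENNReal.ofReal h⁻¹ *
      {x | t < |u x| ∧ |u x| < t + h}.indicator (fun x => ‖gradient u x‖ₑ) x := by
  rcases le_or_gt (|u x|) t with h1 | h1
  · have hmin : IsLocalMin (EndpointSobolev.ramp t h u) x := Eventually.of_forall fun y => by
      rw [ramp_eq_zero hh h1]; exact ramp_nonneg _ _ _ _
    rw [gradient, hmin.fderiv_eq_zero, map_zero, enorm_zero]; exact zero_le
  rcases le_or_gt (t + h) (|u x|) with h2 | h2
  · have hmax : IsLocalMax (EndpointSobolev.ramp t h u) x := Eventually.of_forall fun y => by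
      rw [ramp_eq_one hh h2]; exact ramp_le_one _ _ _ _
    rw [gradient, hmax.fderiv_eq_zero, map_zero, enorm_zero]; exact zero_le
  rw [indicator_of_mem (show x ∈ {x | t < |u x| ∧ |u x| < t + h} from ⟨h1, h2⟩), enorm_gradient,
    enorm_gradient]
  have hev : ∀ᶠ y in 𝓝 x, t < |u y| ∧ |u y| < t + h :=
    (hu.abs.continuousAt.eventually_const_lt h1).and (hu.abs.continuousAt.eventually_lt_const h2)
  have hux : u x ≠ 0 := abs_pos.1 (ht.trans_lt h1)
  obtain ⟨σ, hσ, hσu⟩ : ∃ σ : ℝ, |σ| = 1 ∧ ∀ᶠ y in 𝓝 x, |u y| = σ * u y := by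
    rcases lt_or_gt_of_ne hux with h0 | h0
    · refine ⟨-1, by simp, ?_⟩
      filter_upwards [hu.continuousAt.eventually_lt_const h0] with y hy
      rw [abs_of_neg hy]; ring
    · refine ⟨1, by simp, ?_⟩
      filter_upwards [hu.continuousAt.eventually_const_lt h0] with y hy
      rw [abs_of_pos hy]; ring
  have heq : EndpointSobolev.ramp t h u =ᶠ[𝓝 x] fun y => (h⁻¹ * σ) • u y - t / h := by
    filter_upwards [hev, hσu] with y hy hy'
    rw [ramp_eq_div hh hy.1 hy.2, hy', smul_eq_mul]
    field_simp
  have hsm : fderiv ℝ (fun y => (h⁻¹ * σ) • u y) x = (h⁻¹ * σ) • fderiv ℝ u x :=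
    congrFun (fderiv_const_smul_field (h⁻¹ * σ) (f := u)) x
  rw [heq.fderiv_eq, fderiv_sub_const, hsm, enorm_smul]
  refine le_of_eq ?_
  congr 1
  rw [← ofReal_norm, norm_mul, Real.norm_eq_abs σ, hσ, mul_one, Real.norm_of_nonneg (by positivity)]

/-- The ramps tend pointwise to the indicator of the superlevel set, with `|div Φ|` dominating. Each
ramp is integrated by parts against an admissible field, whose norm is at most `w`. -/
theorem weightedPer_superlevel_le_liminf {u : EuclideanSpace ℝ (Fin n) → ℝ} (hu : IsLipc u)
    {t : ℝ} (ht : 0 ≤ t) (w : EuclideanSpace ℝ (Fin n) → ℝ≥0∞) :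
    weightedPer {x | t < |u x|} w ≤ liminf (fun k : ℕ => ∫⁻ x,
      ENNReal.ofReal ((1 / ((k : ℝ) + 1))⁻¹) *
      {x | t < |u x| ∧ |u x| < t + 1 / ((k : ℝ) + 1)}.indicator
        (fun x => ‖gradient u x‖ₑ * w x) x) atTop := by
  refine iSup₂_le fun Φ hΦ => ?_
  have hc : Continuous u := hu.1.choose_spec.continuous
  have hlim : Tendsto (fun k : ℕ => ∫ x, ramp t (1 / ((k : ℝ) + 1)) u x * divergence Φ x) atTop
      (𝓝 (∫ x, {x | t < |u x|}.indicator 1 x * divergence Φ x)) := by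
    refine tendsto_integral_of_dominated_convergence (fun x => ‖divergence Φ x‖) (fun k => ?_)
      hΦ.1.integrable_divergence.norm (fun k => ae_of_all _ fun x => ?_) (ae_of_all _ fun x => ?_)
    · obtain ⟨⟨L, hL⟩, -⟩ := hu.ramp ht (h := 1 / ((k : ℝ) + 1)) (by positivity)
      exact hL.continuous.aestronglyMeasurable.mul hΦ.1.integrable_divergence.1
    · rw [norm_mul, Real.norm_of_nonneg (ramp_nonneg _ _ _ _)]
      exact mul_le_of_le_one_left (norm_nonneg _) (ramp_le_one _ _ _ _)
    · refine Tendsto.mul_const _ (tendsto_const_nhds.congr' ?_)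
      rcases le_or_gt (|u x|) t with h1 | h1
      · refine Eventually.of_forall fun k => ?_
        beta_reduce
        rw [ramp_eq_zero (by positivity) h1, indicator_of_notMem (by simpa using h1)]
      · have := (tendsto_one_div_add_atTop_nhds_zero_nat (𝕜 := ℝ)).eventually_lt_const
          (sub_pos.2 h1)
        filter_upwards [this] with k hk
        rw [ramp_eq_one (by positivity) (by linarith), indicator_of_mem (by simpa using h1)]
        rfl
  rw [← ((ENNReal.continuous_ofReal.tendsto _).comp hlim).liminf_eq]
  refine liminf_le_liminf (Eventually.of_forall fun k => ?_)
  have hk : (0 : ℝ) < 1 / ((k : ℝ) + 1) := by positivity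
  refine ((hu.ramp ht hk).ofReal_integral_mul_divergence_le hΦ.1).trans
    (lintegral_mono fun x => ?_)
  refine (mul_le_mul' (enorm_gradient_ramp_le hc ht hk x) (hΦ.2 x)).trans ?_
  rw [mul_assoc]
  gcongr
  by_cases hx : x ∈ {x | t < |u x| ∧ |u x| < t + 1 / ((k : ℝ) + 1)}
  · rw [indicator_of_mem hx, indicator_of_mem hx]
  · rw [indicator_of_notMem hx, indicator_of_notMem hx, zero_mul]

/-- An open ball is the increasing union of smaller concentric ones, and a slightly smaller ball
stays inside when the centre moves little. This yields measurability of the maximal function. -/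
theorem lowerSemicontinuous_measure_ball {X : Type*} [PseudoMetricSpace X] [MeasurableSpace X]
    (μ : Measure X) (r : ℝ) : LowerSemicontinuous fun x => μ (ball x r) := by
  intro x a ha
  have hU : ball x r = ⋃ k : ℕ, ball x (r - 1 / ((k : ℝ) + 1)) := by
    refine Subset.antisymm (fun y hy => ?_) (iUnion_subset fun k => ball_subset_ball ?_)
    · obtain ⟨k, hk⟩ := exists_nat_one_div_lt (sub_pos.2 (mem_ball.1 hy))
      exact mem_iUnion.2 ⟨k, mem_ball.2 (by linarith)⟩
    · have : 0 ≤ 1 / ((k : ℝ) + 1) := by positivity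
      linarith
  have hmono : Monotone fun k : ℕ => ball x (r - 1 / ((k : ℝ) + 1)) := fun k l hkl =>
    ball_subset_ball (sub_le_sub_left (one_div_le_one_div_of_le (by positivity) (by gcongr)) _)
  simp only [hU, hmono.measure_iUnion, lt_iSup_iff] at ha
  obtain ⟨k, hk⟩ := ha
  have hpos : 0 < 1 / ((k : ℝ) + 1) := by positivity
  filter_upwards [ball_mem_nhds x hpos] with y hy
  refine hk.trans_le (measure_mono (ball_subset_ball' ?_))
  rw [mem_ball, dist_comm] at hy
  linarith

theorem measurable_fracMaximal (α : ℝ) (μ : Measure (EuclideanSpace ℝ (Fin n))) :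
    Measurable (fracMaximal α μ) := by
  refine LowerSemicontinuous.measurable ?_
  refine lowerSemicontinuous_iSup fun r => lowerSemicontinuous_iSup fun hr => ?_
  have hpos : 0 < r ^ n * ballVol n := mul_pos (pow_pos hr n) (ballVol_pos n)
  have h : ∀ x : EuclideanSpace ℝ (Fin n),
      ENNReal.ofReal (r ^ α) * (μ (ball x r) / volume (ball x r)) =
      (ENNReal.ofReal (r ^ α) * (ENNReal.ofReal (r ^ n * ballVol n))⁻¹) * μ (ball x r) :=
    fun x => by rw [volume_ball_eq _ hr, div_eq_mul_inv, mul_assoc, mul_comm (μ _)]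
  simp_rw [h]
  exact (ENNReal.continuous_const_mul (ENNReal.mul_ne_top ENNReal.ofReal_ne_top
    (ENNReal.inv_ne_top.2 (ENNReal.ofReal_pos.2 hpos).ne'))).comp_lowerSemicontinuous
    (lowerSemicontinuous_measure_ball μ r) fun a b hab => mul_le_mul_right hab _

/-- One half of the coarea formula, for the weighted perimeter. -/
theorem lintegral_weightedPer_superlevel_le {u : EuclideanSpace ℝ (Fin n) → ℝ} (hu : IsLipc u)
    {w : EuclideanSpace ℝ (Fin n) → ℝ≥0∞} (hw : Measurable w) :
    ∫⁻ t in Ioi (0 : ℝ), weightedPer {x | t < |u x|} w ≤ gradNorm u w := by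
  have hc : Continuous u := hu.1.choose_spec.continuous
  set g : EuclideanSpace ℝ (Fin n) → ℝ≥0∞ := fun x => ‖gradient u x‖ₑ * w x with hg
  have hgm : Measurable g := by
    have h1 : (fun x => ‖gradient u x‖ₑ) = fun x => ‖fderiv ℝ u x‖ₑ :=
      funext fun x => enorm_gradient u x
    refine Measurable.mul ?_ hw
    rw [h1]
    exact (measurable_fderiv ℝ u).enorm
  have hjoint : ∀ k : ℕ, Measurable fun p : ℝ × EuclideanSpace ℝ (Fin n) =>
      ENNReal.ofReal ((1 / ((k : ℝ) + 1))⁻¹) *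
        {x | p.1 < |u x| ∧ |u x| < p.1 + 1 / ((k : ℝ) + 1)}.indicator g p.2 := fun k => by
    refine Measurable.const_mul ?_ _
    have hS : MeasurableSet {p : ℝ × EuclideanSpace ℝ (Fin n) |
        p.1 < |u p.2| ∧ |u p.2| < p.1 + 1 / ((k : ℝ) + 1)} :=
      (measurableSet_lt measurable_fst (hc.abs.measurable.comp measurable_snd)).inter
        (measurableSet_lt (hc.abs.measurable.comp measurable_snd) (measurable_fst.add_const _))
    exact (hgm.comp measurable_snd).indicator hS
  calc ∫⁻ t in Ioi (0 : ℝ), weightedPer {x | t < |u x|} w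
      ≤ ∫⁻ t in Ioi (0 : ℝ), liminf (fun k : ℕ => ∫⁻ x,
          ENNReal.ofReal ((1 / ((k : ℝ) + 1))⁻¹) *
          {x | t < |u x| ∧ |u x| < t + 1 / ((k : ℝ) + 1)}.indicator g x) atTop :=
        setLIntegral_mono' measurableSet_Ioi fun t ht =>
          weightedPer_superlevel_le_liminf hu (le_of_lt ht) w
    _ ≤ liminf (fun k : ℕ => ∫⁻ t in Ioi (0 : ℝ), ∫⁻ x,
          ENNReal.ofReal ((1 / ((k : ℝ) + 1))⁻¹) *
          {x | t < |u x| ∧ |u x| < t + 1 / ((k : ℝ) + 1)}.indicator g x) atTop :=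
        lintegral_liminf_le' fun k => (hjoint k).lintegral_prod_right'.aemeasurable
    _ ≤ gradNorm u w := by
        refine liminf_le_of_frequently_le' (Frequently.of_forall fun k => ?_)
        -- For fixed `x` the admissible levels form an interval of length `1 / (k + 1)`, which
        -- cancels the slope of the ramp.
        rw [lintegral_lintegral_swap (hjoint k).aemeasurable]
        refine lintegral_mono fun x => ?_
        have hk : (0 : ℝ) < 1 / ((k : ℝ) + 1) := by positivity
        calc _ ≤ ∫⁻ t, ENNReal.ofReal ((1 / ((k : ℝ) + 1))⁻¹) *
              {x | t < |u x| ∧ |u x| < t + 1 / ((k : ℝ) + 1)}.indicator g x :=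
              setLIntegral_le_lintegral _ _
          _ = ∫⁻ t, (Ioo (|u x| - 1 / ((k : ℝ) + 1)) (|u x|)).indicator
              (fun _ => ENNReal.ofReal ((1 / ((k : ℝ) + 1))⁻¹) * g x) t := by
              refine lintegral_congr fun t => ?_
              by_cases ht : t < |u x| ∧ |u x| < t + 1 / ((k : ℝ) + 1)
              · rw [indicator_of_mem (show x ∈ {x | t < |u x| ∧ |u x| < t + 1 / ((k : ℝ) + 1)} from ht), indicator_of_mem
                  (show t ∈ Ioo _ _ from ⟨by linarith [ht.2], ht.1⟩)]
              · rw [indicator_of_notMem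
                  (show x ∉ {x | t < |u x| ∧ |u x| < t + 1 / ((k : ℝ) + 1)} from ht), indicator_of_notMem
                  (fun h => ht ⟨h.2, by linarith [h.1]⟩), mul_zero]
          _ = g x := by
              rw [lintegral_indicator measurableSet_Ioo, setLIntegral_const, Real.volume_Ioo,
                sub_sub_cancel, mul_right_comm, ← ENNReal.ofReal_mul (by positivity),
                inv_mul_cancel₀ hk.ne', ENNReal.ofReal_one, one_mul]
          _ ≤ _ := le_rfl

/-! ### The Lorentz and weak-type inequalities -/

theorem lorentzNorm_one {q : ℝ} (μ : Measure (EuclideanSpace ℝ (Fin n)))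
    (u : EuclideanSpace ℝ (Fin n) → ℝ) :
    lorentzNorm q 1 μ u =
      ENNReal.ofReal q * ∫⁻ t in Ioi (0 : ℝ), μ {x | t < |u x|} ^ (1 / q) := by
  simp [lorentzNorm]

theorem isOpen_superlevel {u : EuclideanSpace ℝ (Fin n) → ℝ} (hu : IsLipc u) (t : ℝ) :
    IsOpen {x | t < |u x|} :=
  isOpen_lt continuous_const hu.1.choose_spec.continuous.abs

theorem isBounded_superlevel {u : EuclideanSpace ℝ (Fin n) → ℝ} (hu : IsLipc u) {t : ℝ}
    (ht : 0 ≤ t) : Bornology.IsBounded {x | t < |u x|} :=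
  hu.2.isCompact.isBounded.subset fun _ hx =>
    subset_tsupport u (abs_pos.1 (lt_of_le_of_lt ht hx))

/-- Integrate the isoperimetric inequality over the superlevel sets and apply the coarea half.
Bounding the prefactor `q` by 2 keeps the constant dimensional. -/
theorem lorentzSobolev_isoConst (hn : n ≠ 0) {q α : ℝ} (hq : 1 ≤ q) (hq2 : q ≤ 2)
    (hα : α = (n : ℝ) - q * ((n : ℝ) - 1)) :
    LorentzSobolev n q α (2 * (isoConst n).toNNReal) := by
  intro μ _ u hu
  have hw : Measurable fun x => fracMaximal α μ x ^ (1 / q) :=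
    (measurable_fracMaximal α μ).pow_const _
  rw [lorentzNorm_one]
  calc _ ≤ ENNReal.ofReal 2 * ∫⁻ t in Ioi (0 : ℝ), ENNReal.ofReal (isoConst n) *
        weightedPer {x | t < |u x|} (fun x => fracMaximal α μ x ^ (1 / q)) := by
        gcongr ENNReal.ofReal ?_ * ?_
        exact setLIntegral_mono' measurableSet_Ioi fun t ht => measure_rpow_le_weightedPer hn hq
          hα μ (isOpen_superlevel hu t) (isBounded_superlevel hu (le_of_lt ht))
    _ ≤ ENNReal.ofReal 2 * (ENNReal.ofReal (isoConst n) *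
          gradNorm u fun x => fracMaximal α μ x ^ (1 / q)) := by
        rw [lintegral_const_mul' _ _ ENNReal.ofReal_ne_top]
        gcongr
        exact lintegral_weightedPer_superlevel_le hu hw
    _ = _ := by
        rw [← mul_assoc, ENNReal.ofReal_ofNat]
        simp [ENNReal.ofReal]

theorem isoperimetric_isoConst (hn : n ≠ 0) {q α : ℝ} (hq : 1 ≤ q)
    (hα : α = (n : ℝ) - q * ((n : ℝ) - 1)) :
    Isoperimetric n q α (isoConst n).toNNReal := fun μ _ _ hΩ hb _ =>
  measure_rpow_le_weightedPer hn hq hα μ hΩ hb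

theorem weakLorentzNorm_le_lorentzNorm {q : ℝ} (hq : 1 ≤ q)
    (μ : Measure (EuclideanSpace ℝ (Fin n))) (u : EuclideanSpace ℝ (Fin n) → ℝ) :
    weakLorentzNorm q μ u ≤ lorentzNorm q 1 μ u := by
  rw [lorentzNorm_one]
  refine iSup₂_le fun t ht => ?_
  calc ENNReal.ofReal t * μ {x | t < |u x|} ^ (1 / q)
      = ∫⁻ _ in Ioc 0 t, μ {x | t < |u x|} ^ (1 / q) := by
        rw [setLIntegral_const, Real.volume_Ioc, sub_zero, mul_comm]
    _ ≤ ∫⁻ s in Ioc 0 t, μ {x | s < |u x|} ^ (1 / q) :=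
        setLIntegral_mono' measurableSet_Ioc fun s hs => by
          have : 0 ≤ 1 / q := by positivity
          gcongr
          exact hs.2
    _ ≤ ∫⁻ s in Ioi 0, μ {x | s < |u x|} ^ (1 / q) := lintegral_mono_set fun s hs => hs.1
    _ ≤ _ := le_mul_of_one_le_left (zero_le) (ENNReal.one_le_ofReal.2 hq)

theorem LorentzSobolev.weakSobolev {q α : ℝ} (hq : 1 ≤ q) {C : ℝ≥0}
    (h : LorentzSobolev n q α C) : WeakSobolev n q α C := fun μ _ u hu =>
  (weakLorentzNorm_le_lorentzNorm hq μ u).trans (h μ u hu)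

/-! ### Dirac masses and the subrepresentation formula -/

theorem enorm_le_weakLorentzNorm_dirac (q : ℝ) (x : EuclideanSpace ℝ (Fin n))
    (u : EuclideanSpace ℝ (Fin n) → ℝ) :
    ‖u x‖ₑ ≤ weakLorentzNorm q (Measure.dirac x) u := by
  refine le_of_forall_lt_imp_le_of_dense fun c hc => ?_
  rcases eq_or_ne c 0 with rfl | hc0
  · exact zero_le
  have hct : c ≠ ∞ := (hc.trans_le le_top).ne
  have hpos : 0 < c.toReal := ENNReal.toReal_pos hc0 hct
  have hcx : x ∈ {y | c.toReal < |u y|} := by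
    rw [← ofReal_norm, ENNReal.lt_ofReal_iff_toReal_lt hct] at hc
    exact hc
  refine le_trans ?_ (le_iSup₂ (f := fun (t : ℝ) (_ : 0 < t) =>
    ENNReal.ofReal t * (Measure.dirac x) {y | t < |u y|} ^ (1 / q)) c.toReal hpos)
  rw [Measure.dirac_apply_of_mem hcx, ENNReal.one_rpow, mul_one, ENNReal.ofReal_toReal hct]

/-- Only radii exceeding `|x - y|` see the mass, and `r ^ (α - n)` decreases in `r`; its value at
`|x - y|` gives the Riesz kernel after the `q`-th root. -/
theorem fracMaximal_dirac_rpow_le {q α : ℝ} (hn : 1 ≤ n) (hq : 1 ≤ q)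
    (hα : α = (n : ℝ) - q * ((n : ℝ) - 1)) {x y : EuclideanSpace ℝ (Fin n)} (hxy : y ≠ x) :
    fracMaximal α (Measure.dirac x) y ^ (1 / q) ≤
      ENNReal.ofReal (max 1 (ballVol n)⁻¹) * (‖x - y‖ₑ ^ ((n : ℝ) - 1))⁻¹ := by
  have hω := ballVol_pos n
  have hn' : (0 : ℝ) ≤ (n : ℝ) - 1 := by
    have : (1 : ℝ) ≤ n := by exact_mod_cast hn
    linarith
  have hd : 0 < ‖x - y‖ := norm_pos_iff.2 (sub_ne_zero.2 hxy.symm)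
  have hq0 : 0 < q := by linarith
  have h1 : fracMaximal α (Measure.dirac x) y ≤
      ENNReal.ofReal (‖x - y‖ ^ (-((n : ℝ) - 1) * q) * (ballVol n)⁻¹) := by
    refine iSup₂_le fun r hr => ?_
    by_cases hx : x ∈ ball y r
    · have hdr : ‖x - y‖ ≤ r := by rw [← dist_eq_norm]; exact (mem_ball.1 hx).le
      rw [Measure.dirac_apply_of_mem hx, volume_ball_eq _ hr, ← ENNReal.ofReal_one,
        ← ENNReal.ofReal_div_of_pos (by positivity), ← ENNReal.ofReal_mul (by positivity)]
      apply ENNReal.ofReal_le_ofReal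
      calc r ^ α * (1 / (r ^ n * ballVol n)) = r ^ (-((n : ℝ) - 1) * q) * (ballVol n)⁻¹ := by
            rw [show -((n : ℝ) - 1) * q = α - n by rw [hα]; ring, Real.rpow_sub hr,
              Real.rpow_natCast]
            field_simp
        _ ≤ _ := by
            gcongr ?_ * _
            exact Real.rpow_le_rpow_of_nonpos hd hdr (by nlinarith)
    · rw [Measure.dirac_apply' _ measurableSet_ball, indicator_of_notMem hx]
      simp
  refine (ENNReal.rpow_le_rpow h1 (by positivity)).trans ?_
  rw [ENNReal.ofReal_rpow_of_nonneg (by positivity) (by positivity),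
    Real.mul_rpow (by positivity) (by positivity), ← Real.rpow_mul hd.le, mul_comm,
    ENNReal.ofReal_mul (by positivity)]
  gcongr
  · calc (ballVol n)⁻¹ ^ (1 / q) ≤ (max 1 (ballVol n)⁻¹) ^ (1 / q) := by
          gcongr; exact le_max_right _ _
      _ ≤ (max 1 (ballVol n)⁻¹) ^ (1 : ℝ) := by
          gcongr
          · exact le_max_left _ _
          · rw [div_le_one hq0]; exact hq
      _ = _ := Real.rpow_one _
  · rw [← ofReal_norm, ENNReal.ofReal_rpow_of_pos hd, ← ENNReal.ofReal_inv_of_pos (by positivity),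
      ← Real.rpow_neg hd.le]
    apply le_of_eq
    congr 2
    field_simp

theorem rieszConst_one_pos (hn : 2 ≤ n) : 0 < rieszConst n 1 := by
  have : (2 : ℝ) ≤ n := by exact_mod_cast hn
  have h1 : 0 < Real.Gamma (((n : ℝ) - 1) / 2) := Real.Gamma_pos_of_pos (by linarith)
  have h2 : 0 < Real.Gamma ((1 : ℝ) / 2) := Real.Gamma_pos_of_pos (by norm_num)
  rw [rieszConst]
  positivity

/-- The constant relating the weak-type inequality to the subrepresentation formula. -/
def reprConst (n : ℕ) : ℝ≥0 := (max 1 (ballVol n)⁻¹ * rieszConst n 1).toNNReal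

theorem WeakSobolev.subrepresentation {q α : ℝ} (hn : 2 ≤ n) (hq : 1 ≤ q)
    (hα : α = (n : ℝ) - q * ((n : ℝ) - 1)) {C : ℝ≥0}
    (h : WeakSobolev n q α C) : Subrepresentation n (reprConst n * C) := by
  intro u hu x
  have hγ := rieszConst_one_pos hn
  have hne : NeZero n := ⟨by omega⟩
  refine (enorm_le_weakLorentzNorm_dirac q x u).trans
    ((h (Measure.dirac x) u hu).trans ?_)
  have hgrad : gradNorm u (fun y => fracMaximal α (Measure.dirac x) y ^ (1 / q)) ≤
      ENNReal.ofReal (max 1 (ballVol n)⁻¹) *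
        ∫⁻ y, ‖gradient u y‖ₑ / (‖x - y‖ₑ ^ ((n : ℝ) - 1)) := by
    rw [← lintegral_const_mul' _ _ ENNReal.ofReal_ne_top]
    refine lintegral_mono_ae ?_
    have : ∀ᵐ y : EuclideanSpace ℝ (Fin n), y ≠ x := by simp [ae_iff]
    filter_upwards [this] with y hy
    calc _ ≤ ‖gradient u y‖ₑ * (ENNReal.ofReal (max 1 (ballVol n)⁻¹) *
          (‖x - y‖ₑ ^ ((n : ℝ) - 1))⁻¹) := by
          gcongr; exact fracMaximal_dirac_rpow_le (by omega) hq hα hy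
      _ = _ := by rw [div_eq_mul_inv]; ring
  calc _ ≤ C * (ENNReal.ofReal (max 1 (ballVol n)⁻¹) *
        ∫⁻ y, ‖gradient u y‖ₑ / (‖x - y‖ₑ ^ ((n : ℝ) - 1))) := by gcongr
    _ = C * (ENNReal.ofReal (max 1 (ballVol n)⁻¹) * (ENNReal.ofReal (rieszConst n 1) *
          rieszPotential 1 (fun y => ‖gradient u y‖ₑ) x)) := by
        rw [rieszPotential, ENNReal.mul_div_cancel (ENNReal.ofReal_pos.2 hγ).ne'
          ENNReal.ofReal_ne_top]
    _ = _ := by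
        rw [reprConst, ENNReal.coe_mul, ← mul_assoc (ENNReal.ofReal _),
          ← ENNReal.ofReal_mul (by positivity), ← mul_assoc, mul_comm (C : ℝ≥0∞)]
        rfl

/-! ### Lower bounds for the constants -/

/-- The cutoff equal to `1` on the unit ball and to `0` outside the ball of radius `2`. -/
def cutoff (x : EuclideanSpace ℝ (Fin n)) : ℝ := max 0 (min 1 (2 - ‖x‖))

theorem cutoff_nonneg (x : EuclideanSpace ℝ (Fin n)) : 0 ≤ cutoff x := le_max_left _ _

theorem cutoff_le_one (x : EuclideanSpace ℝ (Fin n)) : cutoff x ≤ 1 :=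
  max_le zero_le_one (min_le_left _ _)

theorem cutoff_eq_one {x : EuclideanSpace ℝ (Fin n)} (hx : ‖x‖ ≤ 1) : cutoff x = 1 := by
  rw [cutoff, min_eq_left (by linarith), max_eq_right zero_le_one]

theorem cutoff_eq_zero {x : EuclideanSpace ℝ (Fin n)} (hx : 2 ≤ ‖x‖) : cutoff x = 0 :=
  max_eq_left ((min_le_right _ _).trans (by linarith))

theorem lipschitzWith_cutoff : LipschitzWith 1 (cutoff (n := n)) := by
  have h : LipschitzWith 1 fun x : EuclideanSpace ℝ (Fin n) => 2 - ‖x‖ :=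
    LipschitzWith.of_dist_le_mul fun x y => by
      rw [Real.dist_eq, NNReal.coe_one, one_mul, sub_sub_sub_cancel_left, dist_comm, dist_eq_norm]
      exact abs_norm_sub_norm_le _ _
  exact (h.const_min 1).const_max 0

theorem isLipc_cutoff : IsLipc (cutoff (n := n)) :=
  ⟨⟨1, lipschitzWith_cutoff⟩, HasCompactSupport.intro (isCompact_closedBall 0 2) fun x hx =>
    cutoff_eq_zero (by simpa using (not_le.1 (mt mem_closedBall_zero_iff.2 hx)).le)⟩

theorem gradient_cutoff_of_norm_le_one {x : EuclideanSpace ℝ (Fin n)} (hx : ‖x‖ ≤ 1) :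
    gradient cutoff x = 0 := by
  have h : IsLocalMax cutoff x := Eventually.of_forall fun y => by
    rw [cutoff_eq_one hx]; exact cutoff_le_one y
  rw [gradient, h.fderiv_eq_zero, map_zero]

theorem enorm_gradient_cutoff_le (x : EuclideanSpace ℝ (Fin n)) :
    ‖gradient cutoff x‖ₑ ≤ (ball (0 : EuclideanSpace ℝ (Fin n)) 2).indicator 1 x := by
  by_cases hx : x ∈ ball (0 : EuclideanSpace ℝ (Fin n)) 2
  · rw [indicator_of_mem hx, ← ofReal_norm, norm_gradient]
    have := norm_fderiv_le_of_lipschitz ℝ (lipschitzWith_cutoff (n := n)) (x₀ := x)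
    exact ENNReal.ofReal_le_one.2 (by simpa using this)
  · rw [mem_ball_zero_iff, not_lt] at hx
    have h : IsLocalMin cutoff x := Eventually.of_forall fun y => by
      rw [cutoff_eq_zero hx]; exact cutoff_nonneg y
    rw [gradient, h.fderiv_eq_zero, map_zero, enorm_zero]; exact zero_le

theorem gradNorm_cutoff_le {w : EuclideanSpace ℝ (Fin n) → ℝ≥0∞} (hw : ∀ x, w x ≤ 1) :
    gradNorm cutoff w ≤ ENNReal.ofReal (2 ^ n * ballVol n) := by
  rw [← volume_ball_eq (0 : EuclideanSpace ℝ (Fin n)) two_pos,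
    ← lintegral_indicator_one measurableSet_ball]
  refine lintegral_mono fun x => ?_
  calc ‖gradient cutoff x‖ₑ * w x ≤ (ball (0 : EuclideanSpace ℝ (Fin n)) 2).indicator 1 x * 1 :=
        mul_le_mul' (enorm_gradient_cutoff_le x) (hw x)
    _ = _ := mul_one _

theorem ball_one_subset_superlevel_cutoff {t : ℝ} (ht : t < 1) :
    ball (0 : EuclideanSpace ℝ (Fin n)) 1 ⊆ {x | t < |cutoff x|} := fun x hx => by
  show t < |cutoff x|
  rw [cutoff_eq_one (mem_ball_zero_iff.1 hx).le, abs_one]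
  exact ht

/-- Test with the cutoff at the origin: its gradient vanishes on the unit ball, and outside it the
Riesz kernel is at most 1. -/
theorem Subrepresentation.le_const (hn : 2 ≤ n) {C : ℝ≥0} (h : Subrepresentation n C) :
    rieszConst n 1 ≤ C * (2 ^ n * ballVol n) := by
  have hγ := rieszConst_one_pos hn
  have hω := ballVol_pos n
  have h0 := h cutoff isLipc_cutoff 0
  rw [cutoff_eq_one (by simp)] at h0
  have hI : ∫⁻ y : EuclideanSpace ℝ (Fin n), ‖gradient cutoff y‖ₑ / (‖0 - y‖ₑ ^ ((n : ℝ) - 1)) ≤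
      ENNReal.ofReal (2 ^ n * ballVol n) := by
    rw [← volume_ball_eq (0 : EuclideanSpace ℝ (Fin n)) two_pos,
      ← lintegral_indicator_one measurableSet_ball]
    refine lintegral_mono fun y => ?_
    rcases le_or_gt ‖y‖ 1 with hy | hy
    · simp [gradient_cutoff_of_norm_le_one hy]
    · refine le_trans (ENNReal.div_le_of_le_mul ?_) (enorm_gradient_cutoff_le y)
      refine le_mul_of_one_le_right zero_le (ENNReal.one_le_rpow ?_ ?_)
      · rw [zero_sub, enorm_neg, ← ofReal_norm]
        exact ENNReal.one_le_ofReal.2 hy.le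
      · have : (2 : ℝ) ≤ n := by exact_mod_cast hn
        linarith
  have h1 : ENNReal.ofReal 1 ≤ ENNReal.ofReal (C * (2 ^ n * ballVol n / rieszConst n 1)) := by
    rw [ENNReal.ofReal_mul C.coe_nonneg, ENNReal.ofReal_div_of_pos hγ, ENNReal.ofReal_coe_nnreal]
    calc ENNReal.ofReal 1 = ‖(1 : ℝ)‖ₑ := by simp
      _ ≤ _ := h0
      _ ≤ _ := by rw [rieszPotential]; gcongr
  rw [ENNReal.ofReal_le_ofReal_iff (by positivity), mul_div_assoc', le_div_iff₀ hγ] at h1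
  linarith

/-- For `r ≤ 1` use `r ^ α ≤ 1`; for `r ≥ 1` use `r ^ α ≤ r ^ n` against the total mass.
Nonnegativity of `α` is the condition `q ≤ n / (n - 1)`. -/
theorem fracMaximal_restrict_ball_le_one {α : ℝ} (hα : 0 ≤ α) (hαn : α ≤ n)
    (x : EuclideanSpace ℝ (Fin n)) :
    fracMaximal α (volume.restrict (ball (0 : EuclideanSpace ℝ (Fin n)) 1)) x ≤ 1 := by
  have hω := ballVol_pos n
  refine iSup₂_le fun r hr => ?_
  have hV0 : volume (ball x r) ≠ 0 := (measure_ball_pos _ _ hr).ne'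
  have hVt : volume (ball x r) ≠ ∞ := measure_ball_lt_top.ne
  rw [← mul_div_assoc]
  refine ENNReal.div_le_of_le_mul ?_
  rw [one_mul]
  rcases le_total r 1 with h1 | h1
  · calc _ ≤ 1 * volume (ball x r) := by
          gcongr
          · exact ENNReal.ofReal_le_one.2 (Real.rpow_le_one hr.le h1 hα)
          · exact Measure.restrict_le_self
      _ = _ := one_mul _
  · calc _ ≤ ENNReal.ofReal (r ^ n) * volume (ball (0 : EuclideanSpace ℝ (Fin n)) 1) := by
          refine mul_le_mul' (ENNReal.ofReal_le_ofReal ?_) ?_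
          · rw [← Real.rpow_natCast]
            exact Real.rpow_le_rpow_of_exponent_le h1 hαn
          · rw [Measure.restrict_apply measurableSet_ball]
            exact measure_mono inter_subset_right
      _ = _ := by
          rw [volume_ball_eq _ one_pos, volume_ball_eq _ hr, ← ENNReal.ofReal_mul (by positivity),
            one_pow, one_mul]

theorem min_one_le_rpow {ω q : ℝ} (hω : 0 < ω) (hq : 1 ≤ q) : min 1 ω ≤ ω ^ (1 / q) := by
  have hq0 : 0 < 1 / q := by positivity
  have hq1 : 1 / q ≤ 1 := by rw [div_le_one (by linarith)]; exact hq
  rcases le_total 1 ω with h | h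
  · rw [min_eq_left h]; exact Real.one_le_rpow h hq0.le
  · rw [min_eq_right h]
    simpa using Real.rpow_le_rpow_of_exponent_ge hω h hq1

theorem Isoperimetric.le_const {q α : ℝ} (hq : 1 ≤ q) (hα : 0 ≤ α) (hαn : α ≤ n) {C : ℝ≥0}
    (h : Isoperimetric n q α C) : min 1 (ballVol n) ≤ C * (2 ^ n * ballVol n + 1) := by
  have hω := ballVol_pos n
  set μ := (volume : Measure (EuclideanSpace ℝ (Fin n))).restrict (ball 0 1) with hμ
  set w : EuclideanSpace ℝ (Fin n) → ℝ≥0∞ := fun x => fracMaximal α μ x ^ (1 / q) with hwdef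
  have hwm : Measurable w := (measurable_fracMaximal α μ).pow_const _
  have hw1 : ∀ x, w x ≤ 1 := fun x =>
    ENNReal.rpow_le_one (fracMaximal_restrict_ball_le_one hα hαn x) (by positivity)
  have hcoarea := (lintegral_weightedPer_superlevel_le isLipc_cutoff hwm).trans
    (gradNorm_cutoff_le hw1)
  -- Averaging the coarea bound over levels in `(0, 1)` finds a superlevel set of controlled
  -- perimeter; the extra 1 makes the inequality strict.
  obtain ⟨t, ht, hPt⟩ : ∃ t ∈ Ioo (0 : ℝ) 1, weightedPer {x | t < |cutoff x|} w <
      ENNReal.ofReal (2 ^ n * ballVol n + 1) := by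
    by_contra! hcon
    have h1 : ENNReal.ofReal (2 ^ n * ballVol n + 1) ≤ ENNReal.ofReal (2 ^ n * ballVol n) := by
      calc _ = ∫⁻ _ in Ioo (0 : ℝ) 1, ENNReal.ofReal (2 ^ n * ballVol n + 1) := by
            rw [setLIntegral_const, Real.volume_Ioo]; simp
        _ ≤ ∫⁻ t in Ioo (0 : ℝ) 1, weightedPer {x | t < |cutoff x|} w :=
            setLIntegral_mono' measurableSet_Ioo hcon
        _ ≤ ∫⁻ t in Ioi (0 : ℝ), weightedPer {x | t < |cutoff x|} w :=
            lintegral_mono_set fun t ht => ht.1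
        _ ≤ _ := hcoarea
    rw [ENNReal.ofReal_le_ofReal_iff (by positivity)] at h1
    linarith
  set Ω : Set (EuclideanSpace ℝ (Fin n)) := {x | t < |cutoff x|} with hΩdef
  have hΩ : IsOpen Ω := isOpen_superlevel isLipc_cutoff t
  have hb : Bornology.IsBounded Ω := isBounded_superlevel isLipc_cutoff ht.1.le
  have hfin : volume Ω < ∞ := hb.measure_lt_top
  have hper : HasFinitePer Ω w := by
    refine ⟨((integrable_indicator_iff hΩ.measurableSet).2
      (integrableOn_const hfin.ne)).locallyIntegrable, ?_, hPt.trans ENNReal.ofReal_lt_top⟩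
    refine lt_of_le_of_lt ?_ hfin
    rw [← lintegral_indicator_one hΩ.measurableSet]
    refine lintegral_mono fun x => ?_
    by_cases hx : x ∈ Ω
    · simpa [hx] using hw1 x
    · simp [hx]
  have h1 := h μ Ω hΩ hb hper
  have h2 : μ Ω = ENNReal.ofReal (ballVol n) := by
    rw [hμ, Measure.restrict_apply hΩ.measurableSet,
      inter_eq_self_of_subset_right (ball_one_subset_superlevel_cutoff ht.2),
      volume_ball_eq _ one_pos, one_pow, one_mul]
  rw [h2, ENNReal.ofReal_rpow_of_pos hω] at h1
  have h3 : ENNReal.ofReal (ballVol n ^ (1 / q)) ≤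
      ENNReal.ofReal (C * (2 ^ n * ballVol n + 1)) := by
    rw [ENNReal.ofReal_mul C.coe_nonneg, ENNReal.ofReal_coe_nnreal]
    exact h1.trans (by gcongr)
  rw [ENNReal.ofReal_le_ofReal_iff (by positivity)] at h3
  exact (min_one_le_rpow hω hq).trans h3

/-! ### Monotonicity in the constant and comparison -/

theorem LorentzSobolev.mono {q α : ℝ} {C D : ℝ≥0} (hCD : C ≤ D) (h : LorentzSobolev n q α C) :
    LorentzSobolev n q α D := fun μ _ u hu => (h μ u hu).trans (by gcongr)

theorem WeakSobolev.mono {q α : ℝ} {C D : ℝ≥0} (hCD : C ≤ D) (h : WeakSobolev n q α C) :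
    WeakSobolev n q α D := fun μ _ u hu => (h μ u hu).trans (by gcongr)

theorem Subrepresentation.mono {C D : ℝ≥0} (hCD : C ≤ D) (h : Subrepresentation n C) :
    Subrepresentation n D := fun u hu x => (h u hu x).trans (by gcongr)

theorem Isoperimetric.mono {q α : ℝ} {C D : ℝ≥0} (hCD : C ≤ D) (h : Isoperimetric n q α C) :
    Isoperimetric n q α D := fun μ _ Ω hΩ hb hp => (h μ Ω hΩ hb hp).trans (by gcongr)

theorem reprConst_pos (hn : 2 ≤ n) : 0 < reprConst n := by
  have := rieszConst_one_pos hn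
  have := ballVol_pos n
  rw [reprConst, Real.toNNReal_pos]
  positivity

/-- Each of the four inequalities holds with a dimensional constant, and its best constant is
bounded below by a positive dimensional constant. -/
theorem exists_dimensional_bounds (hn : 2 ≤ n) :
    ∃ A c : ℝ≥0, 0 < c ∧ ∀ q α : ℝ, 1 < q → q ≤ (n : ℝ) / ((n : ℝ) - 1) →
      α = (n : ℝ) - q * ((n : ℝ) - 1) →
      ∀ P ∈ [LorentzSobolev n q α, Subrepresentation n, WeakSobolev n q α, Isoperimetric n q α],
        (∀ C, A ≤ C → P C) ∧ ∀ C, P C → c ≤ C := by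
  have hω := ballVol_pos n
  have hγ := rieszConst_one_pos hn
  have hκ := reprConst_pos hn
  have hn0 : n ≠ 0 := by omega
  set I : ℝ≥0 := (isoConst n).toNNReal
  set κ : ℝ≥0 := reprConst n
  set c₂ : ℝ≥0 := (rieszConst n 1 / (2 ^ n * ballVol n)).toNNReal with hc₂
  set c₄ : ℝ≥0 := (min 1 (ballVol n) / (2 ^ n * ballVol n + 1)).toNNReal with hc₄
  have hc₂pos : 0 < c₂ := by rw [hc₂, Real.toNNReal_pos]; positivity
  have hc₄pos : 0 < c₄ := by rw [hc₄, Real.toNNReal_pos]; positivity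
  refine ⟨max (2 * I) (κ * (2 * I)), min (min c₂ (c₂ / κ)) c₄, by positivity, ?_⟩
  intro q α hq hqn hα
  have hn2 : (2 : ℝ) ≤ n := by exact_mod_cast hn
  have hn1 : 0 < (n : ℝ) - 1 := by linarith
  have hq2 : q ≤ 2 := hqn.trans (by rw [div_le_iff₀ hn1]; linarith)
  have hα0 : 0 ≤ α := by rw [le_div_iff₀ hn1] at hqn; linarith
  have hαn : α ≤ n := by nlinarith
  have hL := lorentzSobolev_isoConst hn0 hq.le hq2 hα
  have hsub : ∀ C, Subrepresentation n C → c₂ ≤ C := fun C h => by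
    rw [hc₂, Real.toNNReal_le_iff_le_coe, div_le_iff₀ (by positivity)]
    exact h.le_const hn
  -- The weak constant, and with it the Lorentz one, inherits its lower bound through the
  -- subrepresentation formula, which holds with constant `κ * C`.
  have hweak : ∀ C, WeakSobolev n q α C → c₂ / κ ≤ C := fun C h =>
    div_le_of_le_mul₀ zero_le zero_le
      ((hsub _ (h.subrepresentation hn hq.le hα)).trans_eq (mul_comm _ _))
  have hiso : ∀ C, Isoperimetric n q α C → c₄ ≤ C := fun C h => by
    rw [hc₄, Real.toNNReal_le_iff_le_coe, div_le_iff₀ (by positivity)]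
    exact h.le_const hq.le hα0 hαn
  have hI2 : I ≤ 2 * I := le_mul_of_one_le_left zero_le one_le_two
  have hm2 : min (min c₂ (c₂ / κ)) c₄ ≤ c₂ / κ := (min_le_left _ _).trans (min_le_right _ _)
  intro P hP
  simp only [List.mem_cons, List.not_mem_nil, or_false] at hP
  rcases hP with rfl | rfl | rfl | rfl
  · exact ⟨fun C hC => hL.mono ((le_max_left _ _).trans hC),
      fun C h => hm2.trans (hweak C (h.weakSobolev hq.le))⟩
  · exact ⟨fun C hC => ((hL.weakSobolev hq.le).subrepresentation hn hq.le hα).mono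
      ((le_max_right _ _).trans hC),
      fun C h => ((min_le_left _ _).trans (min_le_left _ _)).trans (hsub C h)⟩
  · exact ⟨fun C hC => (hL.weakSobolev hq.le).mono ((le_max_left _ _).trans hC),
      fun C h => hm2.trans (hweak C h)⟩
  · exact ⟨fun C hC => (isoperimetric_isoConst hn0 hq.le hα).mono
      ((hI2.trans (le_max_left _ _)).trans hC), fun C h => (min_le_right _ _).trans (hiso C h)⟩

end EndpointSobolev

end

theorem mainTheorem3 (n : ℕ) (hn : 2 ≤ n) :
    ∃ K : ℝ≥0, ∀ q α : ℝ, 1 < q → q ≤ (n : ℝ) / ((n : ℝ) - 1) →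
      α = (n : ℝ) - q * ((n : ℝ) - 1) →
      List.TFAE
        [∃ C₁ : ℝ≥0, EndpointSobolev.LorentzSobolev n q α C₁,
         ∃ C₂ : ℝ≥0, EndpointSobolev.Subrepresentation n C₂,
         ∃ C₃ : ℝ≥0, EndpointSobolev.WeakSobolev n q α C₃,
         ∃ C₄ : ℝ≥0, EndpointSobolev.Isoperimetric n q α C₄] ∧
      ∀ P ∈ [EndpointSobolev.LorentzSobolev n q α, EndpointSobolev.Subrepresentation n,
          EndpointSobolev.WeakSobolev n q α, EndpointSobolev.Isoperimetric n q α],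
        ∀ Q ∈ [EndpointSobolev.LorentzSobolev n q α, EndpointSobolev.Subrepresentation n,
            EndpointSobolev.WeakSobolev n q α, EndpointSobolev.Isoperimetric n q α],
          ∀ C : ℝ≥0, P C → Q (K * C) := by
  obtain ⟨A, c, hc, h⟩ := EndpointSobolev.exists_dimensional_bounds hn
  -- A valid constant `C` for any of the inequalities satisfies `c ≤ C`, so `A / c * C ≥ A` is valid
  -- for every other one.
  refine ⟨A / c, fun q α hq hqn hα => ?_⟩
  have hPQ : ∀ P ∈ [EndpointSobolev.LorentzSobolev n q α, EndpointSobolev.Subrepresentation n,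
      EndpointSobolev.WeakSobolev n q α, EndpointSobolev.Isoperimetric n q α],
      ∀ Q ∈ [EndpointSobolev.LorentzSobolev n q α, EndpointSobolev.Subrepresentation n,
        EndpointSobolev.WeakSobolev n q α, EndpointSobolev.Isoperimetric n q α],
      ∀ C : ℝ≥0, P C → Q (A / c * C) := fun P hP Q hQ C hC => by
    refine (h q α hq hqn hα Q hQ).1 _ ?_
    rw [div_mul_eq_mul_div, le_div_iff₀ hc]
    gcongr
    exact (h q α hq hqn hα P hP).2 C hC
  refine ⟨?_, hPQ⟩
  tfae_have 1 → 2 := fun ⟨C, hC⟩ => ⟨_, hPQ _ (by simp) _ (by simp) C hC⟩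
  tfae_have 2 → 3 := fun ⟨C, hC⟩ =>
    ⟨_, hPQ (EndpointSobolev.Subrepresentation n) (by simp) _ (by simp) C hC⟩
  tfae_have 3 → 4 := fun ⟨C, hC⟩ => ⟨_, hPQ _ (by simp) _ (by simp) C hC⟩
  tfae_have 4 → 1 := fun ⟨C, hC⟩ => ⟨_, hPQ _ (by simp) _ (by simp) C hC⟩
  tfae_finish
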